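/- A locally compact contraction group is a pair $(G,\alpha)$ of a locally compact Hausdorff topological group $G$ and an automorphism $\alpha$ of $G$ (a group automorphism that is continuous with continuous inverse) such that $\lim_{k\to\infty}\alpha^k(x)=e$ for every $x\in G$. An isomorphism $(G,\alpha)\to(H,\beta)$ of contraction groups is an isomorphism of topological groups $\phi\colon G\to H$ with $\beta\circ\phi=\phi\circ\alpha$. Let $\mathbb{P}$ be the set of primes, $\mathbb{N}=\{1,2,\ldots\}$ and $\mathbb{N}_0=\mathbb{N}\cup\{0\}$. For $p\in\mathbb{P}$ and $n\in\mathbb{N}$ let $F_{p^n}:=\mathbb{Z}/p^n\mathbb{Z}$ and let $F_{p^n}(\!(t)\!):=F_{p^n}^{(-\mathbb{N})}\times F_{p^n}^{\mathbb{N}_0}$, where the group $F_{p^n}^{(-\mathbb{N})}$ of finitely supported sequences is discrete and $F_{p^n}^{\mathbb{N}_0}$ carries the compact product topology; let $\alpha_{p^n}\colon (x_i)_{i\in\mathbb{Z}}\mapsto(x_{i-1})_{i\in\mathbb{Z}}$ be the right shift on it. (a) For each family $\nu=(\nu(p,n))_{(p,n)\in\mathbb{P}\times\mathbb{N}}$ of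 numbers in $\mathbb{N}_0$ of which only finitely many are non-zero, the (finite) direct sum $$\bigoplus_{p\in\mathbb{P}}\bigoplus_{n\in\mathbb{N}}\bigl(F_{p^n}(\!(t)\!),\alpha_{p^n}\bigr)^{\nu(p,n)},$$ with the right shift in each component, is a locally compact contraction group which is abelian and a torsion group. (b) Every locally compact contraction group which is abelian and a torsion group is isomorphic, as a contraction group, to one of the contraction groups in (a), for a uniquely determined finitely supported family $\nu$. (c) Up to isomorphism of contraction groups, there are only countably many locally compact contraction groups which are abelian and torsion groups. -/

import Mathlib

open Filter Topology

universe u v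

noncomputable section

/-- The pair `(G, α)` is a locally compact (Hausdorff) abelian contraction group whose underlying
group is a torsion group. The type `G ≃ₜ+ G` consists of the group automorphisms of `G` which are
continuous together with their inverses. -/
structure IsLCATorsionContractionGroup (G : Type u) [AddCommGroup G] [TopologicalSpace G]
    (α : G ≃ₜ+ G) : Prop where
  isTopologicalAddGroup : IsTopologicalAddGroup G
  t2Space : T2Space G
  locallyCompactSpace : LocallyCompactSpace G
  isTorsion : ∀ x : G, IsOfFinAddOrder x
  contractive : ∀ x : G, Tendsto (fun k : ℕ => (α : G → G)^[k] x) atTop (𝓝 0)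

/-- `(G, α)` and `(H, β)` are isomorphic as contraction groups. -/
def ContractionIso {G : Type u} {H : Type v} [AddCommGroup G] [TopologicalSpace G]
    [AddCommGroup H] [TopologicalSpace H] (α : G ≃ₜ+ G) (β : H ≃ₜ+ H) : Prop :=
  ∃ φ : G ≃ₜ+ H, ∀ x : G, φ (α x) = β (φ x)

/-- The class of all locally compact abelian torsion contraction groups (in a given universe). -/
structure LCATorsionContractionGroup : Type (u + 1) where
  carrier : Type u
  [addCommGroup : AddCommGroup carrier]
  [topologicalSpace : TopologicalSpace carrier]
  aut : carrier ≃ₜ+ carrier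
  prop : IsLCATorsionContractionGroup carrier aut

attribute [instance] LCATorsionContractionGroup.addCommGroup
  LCATorsionContractionGroup.topologicalSpace

/-- Isomorphism of contraction groups, as an equivalence relation. -/
instance LCATorsionContractionGroup.isoSetoid : Setoid LCATorsionContractionGroup.{u} where
  r A B := ContractionIso A.aut B.aut
  iseqv :=
    { refl := fun A => ⟨ContinuousAddEquiv.refl A.carrier, fun _ => rfl⟩
      symm := by
        rintro A B ⟨φ, h⟩
        refine ⟨φ.symm, fun y => ?_⟩
        apply φ.injective
        rw [h, φ.apply_symm_apply, φ.apply_symm_apply]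
      trans := by
        rintro A B C ⟨φ, h⟩ ⟨ψ, k⟩
        refine ⟨φ.trans ψ, fun x => ?_⟩
        change ψ (φ (A.aut x)) = C.aut (ψ (φ x))
        rw [h, k] }

/-- The group `F^(-ℕ) × F^ℕ₀` (additively, formal Laurent series over `F`). An element `x`
encodes the two-sided sequence with entry `x.1 k` at place `-(k + 1)` and entry `x.2 j` at
place `j`, for `k, j = 0, 1, 2, …`. -/
def TwoSidedPower (F : Type u) [AddCommGroup F] : Type u := (ℕ →₀ F) × (ℕ → F)

namespace TwoSidedPower

variable (F : Type u) [AddCommGroup F]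

instance : AddCommGroup (TwoSidedPower F) := inferInstanceAs (AddCommGroup ((ℕ →₀ F) × (ℕ → F)))

/-- The product of the discrete topology on `F^(-ℕ)` and the product topology on `F^ℕ₀`, each
factor `F` being discrete. -/
instance : TopologicalSpace (TwoSidedPower F) :=
  @instTopologicalSpaceProd (ℕ →₀ F) (ℕ → F) ⊥ (@Pi.topologicalSpace ℕ (fun _ => F) fun _ => ⊥)

/-- The right shift, moving the entry at place `i` to place `i + 1`. -/
def shift : TwoSidedPower F ≃ₜ+ TwoSidedPower F where
  toFun x := (x.1.comapDomain Nat.succ Nat.succ_injective.injOn,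
    fun j => Nat.casesOn j (x.1 0) x.2)
  invFun x := (Finsupp.single 0 (x.2 0) + x.1.mapDomain Nat.succ, fun j => x.2 (j + 1))
  left_inv x := by
    refine Prod.ext (Finsupp.ext fun k => ?_) rfl
    cases k with
    | zero =>
      have : (0 : ℕ) ∉ Set.range Nat.succ := by simp
      simp [Finsupp.mapDomain_of_notMem_range _ _ this]
    | succ k =>
      simp [← Nat.succ_eq_add_one, Finsupp.mapDomain_apply Nat.succ_injective]
  right_inv x := by
    have h0 : (0 : ℕ) ∉ Set.range Nat.succ := by simp
    refine Prod.ext (Finsupp.ext fun k => ?_) (funext fun j => ?_)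
    · simp [Finsupp.mapDomain_apply Nat.succ_injective]
    · cases j with
      | zero => simp [Finsupp.mapDomain_of_notMem_range _ _ h0]
      | succ j => rfl
  map_add' x y := by
    refine Prod.ext (Finsupp.ext fun k => rfl) (funext fun j => ?_)
    cases j <;> rfl
  continuous_toFun := by
    let : TopologicalSpace F := ⊥
    let : TopologicalSpace (ℕ →₀ F) := ⊥
    have : DiscreteTopology (ℕ →₀ F) := ⟨rfl⟩
    change Continuous fun x : (ℕ →₀ F) × (ℕ → F) =>
      ((x.1.comapDomain Nat.succ Nat.succ_injective.injOn,
        fun j => Nat.casesOn j (x.1 0) x.2) : (ℕ →₀ F) × (ℕ → F))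
    refine Continuous.prodMk ?_ (continuous_pi fun j => ?_)
    · exact (continuous_of_discreteTopology
        (f := fun u : ℕ →₀ F => u.comapDomain Nat.succ Nat.succ_injective.injOn)).comp
        continuous_fst
    · cases j with
      | zero =>
        exact (continuous_of_discreteTopology (f := fun u : ℕ →₀ F => u 0)).comp continuous_fst
      | succ j => exact (continuous_apply j).comp continuous_snd
  continuous_invFun := by
    let : TopologicalSpace F := ⊥
    have : DiscreteTopology F := ⟨rfl⟩
    let : TopologicalSpace (ℕ →₀ F) := ⊥
    have : DiscreteTopology (ℕ →₀ F) := ⟨rfl⟩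
    change Continuous fun x : (ℕ →₀ F) × (ℕ → F) =>
      ((Finsupp.single 0 (x.2 0) + x.1.mapDomain Nat.succ, fun j => x.2 (j + 1)) :
        (ℕ →₀ F) × (ℕ → F))
    refine Continuous.prodMk ?_ (continuous_pi fun j => ?_)
    · exact (continuous_of_discreteTopology
        (f := fun q : (ℕ →₀ F) × F => Finsupp.single 0 q.2 + q.1.mapDomain Nat.succ)).comp
        (continuous_fst.prodMk ((continuous_apply 0).comp continuous_snd))
    · exact (continuous_apply (j + 1)).comp continuous_snd

end TwoSidedPower

/-- The index set of the summands of `⊕_p ⊕_n (ℤ/pⁿℤ)((t))^ν(p,n)`, where `p` ranges over the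
primes and `n` over the positive integers. -/
abbrev SummandIndex (ν : Nat.Primes × ℕ+ →₀ ℕ) : Type :=
  Σ q : Nat.Primes × ℕ+, Fin (ν q)

/-- There are only finitely many summands. -/
instance SummandIndex.finite (ν : Nat.Primes × ℕ+ →₀ ℕ) : Finite (SummandIndex ν) := by
  refine Finite.of_injective
    (fun i : SummandIndex ν => (⟨⟨i.1, ?_⟩, i.2⟩ : Σ q : ν.support, Fin (ν q.1))) ?_
  · rw [Finsupp.mem_support_iff]
    exact fun h => (Fin.cast h i.2).elim0
  · rintro ⟨q, i⟩ ⟨r, j⟩ h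
    simp only [Sigma.mk.injEq, Subtype.mk.injEq] at h
    obtain ⟨rfl, h⟩ := h
    rw [eq_of_heq h]

/-- The direct sum `⊕_p ⊕_n (ℤ/pⁿℤ)((t))^ν(p,n)`. As it has only finitely many summands, it is
their product, with the product topology. -/
abbrev LaurentSum (ν : Nat.Primes × ℕ+ →₀ ℕ) : Type :=
  (i : SummandIndex ν) → TwoSidedPower (ZMod ((i.1.1 : ℕ) ^ (i.1.2 : ℕ)))

/-- The right shift in each component of `⊕_p ⊕_n (ℤ/pⁿℤ)((t))^ν(p,n)`. -/
def LaurentSum.shift (ν : Nat.Primes × ℕ+ →₀ ℕ) : LaurentSum ν ≃ₜ+ LaurentSum ν where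
  toFun x i := TwoSidedPower.shift _ (x i)
  invFun x i := (TwoSidedPower.shift _).symm (x i)
  left_inv x := funext fun i => (TwoSidedPower.shift _).symm_apply_apply (x i)
  right_inv x := funext fun i => (TwoSidedPower.shift _).apply_symm_apply (x i)
  map_add' x y := funext fun i => map_add (TwoSidedPower.shift _) (x i) (y i)
  continuous_toFun := continuous_pi fun i =>
    (TwoSidedPower.shift _).continuous_toFun.comp (continuous_apply i)
  continuous_invFun := continuous_pi fun i =>
    (TwoSidedPower.shift _).continuous_invFun.comp (continuous_apply i)

end

/-! A locally compact abelian torsion group has a compact open subgroup, and by the Baire category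
theorem the contraction `α` shrinks compact sets uniformly. This gives a compact open subgroup `W`
with `α W ⊆ W` and `α^n W → 0` (`exists_isContractionLattice`), so power series in `α` converge and
the group becomes a module over `ℤ⟦X⟧` with `X` acting as `α`. Digit expansions show that `W` lies
in a finitely generated submodule; consequently linear maps are automatically continuous
(`continuous_linearMap`), and the classification becomes algebra.

Baire category also gives a finite exponent, so the module splits into primary parts. On a part of
`p`-power exponent, `X` is invertible and `p` is nilpotent. A series `s` not divisible by `p`
divides a power of `X` modulo `p`, hence acts invertibly. The part is therefore a finitely generated
torsion module over the localization of `ℤ⟦X⟧` at `(p)`, a discrete valuation ring with uniformizer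
`p`, and splits into cyclic modules. The cyclic module of exponent `p^k` is the Laurent series group
over `ℤ/p^k`: both are `ℤ⟦X⟧/(p^k)` with `X` inverted (`IsCyclicModel.nonempty_linearEquiv`).

For uniqueness, an isomorphism and its inverse move entries to the left by bounded amounts only.
Comparing growth rates in the length of sequences shows that the number of constant terms killed by
`t` is an invariant (`card_torsionTerms_eq`). For `t = p^j` its exponent of `p` is a sum of terms
`min n j`, and second differences in `j` recover `ν`. Countability follows because there are only
countably many finitely supported `ν`. -/

open scoped Pointwise

/-! ### Compact open subgroups, finite exponent and uniform contraction. -/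

section Torsion

variable {G : Type u} [AddCommGroup G] [TopologicalSpace G]

/-- A locally compact abelian torsion group has a compact open subgroup. -/
theorem exists_isCompact_isOpen_addSubgroup_of_isTorsion [IsTopologicalAddGroup G]
    [LocallyCompactSpace G] (ht : ∀ x : G, IsOfFinAddOrder x) :
    ∃ W : AddSubgroup G, IsCompact (W : Set G) ∧ IsOpen (W : Set G) := by
  obtain ⟨U₀, hU₀, hU₀n⟩ := exists_compact_mem_nhds (0 : G)
  set U : Set G := U₀ ∪ -U₀ with hU
  have hUc : IsCompact U := hU₀.union hU₀.neg
  have hUn : U ∈ 𝓝 (0 : G) := mem_of_superset hU₀n Set.subset_union_left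
  have hUneg : ∀ x ∈ U, -x ∈ U := by
    rintro x (hx | hx)
    · exact Or.inr (by simpa using hx)
    · exact Or.inl hx
  -- Finitely many translates of `U` cover `U + U`. The translating elements generate a finite group
  -- `Z`, and `U + Z` is then closed under addition.
  obtain ⟨F, -, hF⟩ := (hUc.add hUc).elim_nhds_subcover (fun x => (fun y => y - x) ⁻¹' U)
    (fun x _ => by
      apply (continuous_id.sub continuous_const).continuousAt.preimage_mem_nhds
      simpa using hUn)
  have hfin : Finite (AddSubgroup.closure (F : Set G)) := by
    refine AddCommGroup.finite_of_fg_isAddTorsion _ fun x => ?_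
    have := ht (x : G)
    rw [isOfFinAddOrder_iff_nsmul_eq_zero] at this ⊢
    obtain ⟨n, hn, h⟩ := this
    exact ⟨n, hn, Subtype.ext (by simpa using h)⟩
  set Z := AddSubgroup.closure (F : Set G) with hZ
  have hadd : ∀ x ∈ U, ∀ y ∈ U, ∃ u ∈ U, ∃ z ∈ Z, x + y = u + z := by
    intro x hx y hy
    obtain ⟨f, hf, hfu⟩ := Set.mem_iUnion₂.1 (hF (Set.add_mem_add hx hy))
    exact ⟨_, hfu, f, AddSubgroup.subset_closure hf, (sub_add_cancel _ _).symm⟩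
  let W : AddSubgroup G :=
    { carrier := U + (Z : Set G)
      zero_mem' := ⟨0, mem_of_mem_nhds hUn, 0, Z.zero_mem, by simp⟩
      add_mem' := by
        rintro _ _ ⟨x, hx, z, hz, rfl⟩ ⟨y, hy, w, hw, rfl⟩
        obtain ⟨u, hu, t, htZ, h⟩ := hadd x hx y hy
        refine ⟨u, hu, t + (z + w), Z.add_mem htZ (Z.add_mem hz hw), ?_⟩
        change u + (t + (z + w)) = (x + z) + (y + w)
        rw [← add_assoc, ← h]; abel
      neg_mem' := by
        rintro _ ⟨x, hx, z, hz, rfl⟩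
        exact ⟨-x, hUneg x hx, -z, Z.neg_mem hz, by simp [add_comm]⟩ }
  refine ⟨W, hUc.add (Set.toFinite (Z : Set G)).isCompact, ?_⟩
  refine W.isOpen_of_mem_nhds (g := 0) (mem_of_superset hUn fun x hx => ?_)
  exact ⟨x, hx, 0, Z.zero_mem, by simp⟩

/-- A locally compact torsion group with a contractive automorphism has finite exponent. -/
theorem exists_nsmul_eq_zero_of_contractive [IsTopologicalAddGroup G] [T2Space G]
    [LocallyCompactSpace G] (ht : ∀ x : G, IsOfFinAddOrder x) (α : G ≃ₜ+ G)
    (hc : ∀ x : G, Tendsto (fun k : ℕ => (α : G → G)^[k] x) atTop (𝓝 0)) :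
    ∃ m : ℕ, 0 < m ∧ ∀ x : G, m • x = 0 := by
  have hcl : ∀ n : ℕ, IsClosed {x : G | (n + 1) • x = 0} := fun n =>
    isClosed_eq (continuous_const_smul _) continuous_const
  have hun : ⋃ n : ℕ, {x : G | (n + 1) • x = 0} = Set.univ := by
    refine Set.eq_univ_of_forall fun x => ?_
    obtain ⟨n, hn, h⟩ := isOfFinAddOrder_iff_nsmul_eq_zero.1 (ht x)
    refine Set.mem_iUnion.2 ⟨n - 1, ?_⟩
    simpa [Nat.sub_add_cancel hn] using h
  -- By Baire category some `(n + 1)`-torsion subgroup is open; every orbit enters it, and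
  -- injectivity of `α` pulls the relation back along the orbit.
  obtain ⟨n, x, hx⟩ := nonempty_interior_of_iUnion_of_closed hcl hun
  refine ⟨n + 1, n.succ_pos, fun y => ?_⟩
  have hker : ((nsmulAddMonoidHom (n + 1) : G →+ G).ker : Set G) = {x : G | (n + 1) • x = 0} := by
    ext; simp [AddMonoidHom.mem_ker]
  have hopen : IsOpen ((nsmulAddMonoidHom (n + 1) : G →+ G).ker : Set G) := by
    refine AddSubgroup.isOpen_of_mem_nhds _ (g := x) ?_
    rw [hker]; exact mem_interior_iff_mem_nhds.1 hx
  obtain ⟨k, hk⟩ := ((hc y).eventually_mem (hopen.mem_nhds (zero_mem _))).exists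
  rw [SetLike.mem_coe, AddMonoidHom.mem_ker, nsmulAddMonoidHom_apply, ← iterate_map_nsmul] at hk
  exact α.injective.iterate k (hk.trans (iterate_map_zero α k).symm)

/-- Contractivity is uniform on compact sets. -/
theorem exists_forall_iterate_mem_of_isCompact [IsTopologicalAddGroup G] [T2Space G]
    [LocallyCompactSpace G] (α : G ≃ₜ+ G)
    (hc : ∀ x : G, Tendsto (fun k : ℕ => (α : G → G)^[k] x) atTop (𝓝 0))
    {K U : Set G} (hK : IsCompact K) (hU : U ∈ 𝓝 (0 : G)) :
    ∃ N : ℕ, ∀ n ≥ N, ∀ x ∈ K, (α : G → G)^[n] x ∈ U := by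
  -- Three terms are needed because a point of `K` is written below as `f + (y - x₀)`, with `f` from
  -- a finite set and `y` near the Baire point `x₀`.
  have hcont : Continuous fun q : G × G × G => q.1 + (q.2.1 - q.2.2) := by fun_prop
  have hU3 : (fun q : G × G × G => q.1 + (q.2.1 - q.2.2)) ⁻¹' U ∈ 𝓝 ((0 : G), (0 : G), (0 : G)) :=
    hcont.continuousAt.preimage_mem_nhds (by simpa using hU)
  simp only [nhds_prod_eq, mem_prod_iff] at hU3
  obtain ⟨V₁, hV₁, V₂₃, ⟨V₂, hV₂, V₃, hV₃, hV₂₃⟩, hV⟩ := hU3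
  obtain ⟨V, hVn, hVc, hVs⟩ := exists_mem_nhds_isClosed_subset (inter_mem hV₁ (inter_mem hV₂ hV₃))
  have hVU : ∀ x ∈ V, ∀ y ∈ V, ∀ z ∈ V, x + (y - z) ∈ U := fun x hx y hy z hz =>
    hV (Set.mk_mem_prod (hVs hx).1 (hV₂₃ (Set.mk_mem_prod (hVs hy).2.1 (hVs hz).2.2)))
  have hcl : ∀ N : ℕ, IsClosed {x : G | ∀ n ≥ N, (α : G → G)^[n] x ∈ V} := fun N => by
    simp only [Set.ofPred_forall]
    exact isClosed_iInter fun n => isClosed_iInter fun _ =>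
      hVc.preimage (α.continuous_toFun.iterate n)
  have hun : ⋃ N : ℕ, {x : G | ∀ n ≥ N, (α : G → G)^[n] x ∈ V} = Set.univ :=
    Set.eq_univ_of_forall fun x => Set.mem_iUnion.2
      (eventually_atTop.1 ((hc x).eventually_mem hVn))
  obtain ⟨N, x₀, hx₀⟩ := nonempty_interior_of_iUnion_of_closed hcl hun
  rw [mem_interior_iff_mem_nhds] at hx₀
  obtain ⟨F, -, hF⟩ := hK.elim_nhds_subcover
    (fun x => (fun y => x₀ + (y - x)) ⁻¹' {x : G | ∀ n ≥ N, (α : G → G)^[n] x ∈ V})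
    (fun x _ => by
      apply ContinuousAt.preimage_mem_nhds (by fun_prop)
      simpa using hx₀)
  have hFe : ∀ᶠ n in atTop, ∀ x ∈ F, (α : G → G)^[n] x ∈ V :=
    (eventually_all_finset F).2 fun x _ => (hc x).eventually_mem hVn
  obtain ⟨N', hN'⟩ := eventually_atTop.1 hFe
  refine ⟨max N N', fun n hn x hx => ?_⟩
  obtain ⟨f, hf, hfx⟩ := Set.mem_iUnion₂.1 (hF hx)
  have h := hVU _ (hN' n (le_of_max_le_right hn) f hf) _ (hfx n (le_of_max_le_left hn)) _
    (mem_of_mem_nhds hx₀ n (le_of_max_le_left hn))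
  rw [← iterate_map_sub, ← iterate_map_add] at h
  have hx : f + ((x₀ + (x - f)) - x₀) = x := by abel
  rwa [← hx]

/-- A compact open subgroup which is mapped into itself by `α`, and whose iterated images under
`α` shrink to zero. -/
structure IsContractionLattice (α : G ≃ₜ+ G) (W : AddSubgroup G) : Prop where
  isCompact : IsCompact (W : Set G)
  isOpen : IsOpen (W : Set G)
  map_mem : ∀ x ∈ W, α x ∈ W
  exists_iterate_mem : ∀ U ∈ 𝓝 (0 : G), ∃ N : ℕ, ∀ n ≥ N, ∀ x ∈ W, (α : G → G)^[n] x ∈ U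

/-- The points whose whole forward orbit stays in a compact open subgroup `W` form an invariant
subgroup. Since `α^n W ⊆ W` for all `n ≥ N`, only finitely many of the defining conditions matter,
so this subgroup is still open. -/
theorem IsLCATorsionContractionGroup.exists_isContractionLattice {α : G ≃ₜ+ G}
    (h : IsLCATorsionContractionGroup G α) : ∃ W : AddSubgroup G, IsContractionLattice α W := by
  have := h.isTopologicalAddGroup
  have := h.t2Space
  have := h.locallyCompactSpace
  obtain ⟨W, hWc, hWo⟩ := exists_isCompact_isOpen_addSubgroup_of_isTorsion h.isTorsion
  obtain ⟨N, hN⟩ := exists_forall_iterate_mem_of_isCompact α h.contractive hWc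
    (hWo.mem_nhds W.zero_mem)
  have hcont : ∀ n : ℕ, Continuous (α : G → G)^[n] := α.continuous_toFun.iterate
  have heq : {x : G | ∀ n : ℕ, (α : G → G)^[n] x ∈ W} =
      ⋂ n ∈ Finset.range (N + 1), (α : G → G)^[n] ⁻¹' W := by
    ext x
    simp only [Set.mem_iInter, Finset.mem_range, Set.mem_preimage, SetLike.mem_coe]
    refine ⟨fun hx n _ => hx n, fun hx n => ?_⟩
    rcases lt_or_ge n N with hn | hn
    · exact hx n (by omega)
    · exact hN n hn x (hx 0 N.succ_pos)
  let W' : AddSubgroup G :=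
    { carrier := {x : G | ∀ n : ℕ, (α : G → G)^[n] x ∈ W}
      zero_mem' := fun n => by rw [iterate_map_zero]; exact W.zero_mem
      add_mem' := fun hx hy n => by rw [iterate_map_add]; exact W.add_mem (hx n) (hy n)
      neg_mem' := fun hx n => by rw [iterate_map_neg]; exact W.neg_mem (hx n) }
  have hle : (W' : Set G) ⊆ W := fun x hx => hx 0
  have hclosed : IsClosed (W : Set G) := W.isClosed_of_isOpen hWo
  refine ⟨W', hWc.of_isClosed_subset ?_ hle, ?_, fun x hx n => ?_, fun U hU => ?_⟩
  · change IsClosed {x : G | ∀ n : ℕ, (α : G → G)^[n] x ∈ W}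
    rw [heq]
    exact isClosed_biInter fun n _ => hclosed.preimage (hcont n)
  · change IsOpen {x : G | ∀ n : ℕ, (α : G → G)^[n] x ∈ W}
    rw [heq]
    exact isOpen_biInter_finset fun n _ => hWo.preimage (hcont n)
  · rw [← Function.iterate_succ_apply]
    exact hx (n + 1)
  · obtain ⟨M, hM⟩ := exists_forall_iterate_mem_of_isCompact α h.contractive hWc hU
    exact ⟨M, fun n hn x hx => hM n hn x (hle hx)⟩

end Torsion

open PowerSeries (trunc)
open scoped PowerSeries

/-! ### The action of `ℤ⟦X⟧` and automatic continuity. -/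

section PowerSeriesAction

variable {G : Type u} [AddCommGroup G] [TopologicalSpace G]

/-- An automorphism of a topological abelian group, as a `ℤ`-linear endomorphism. -/
noncomputable def ContinuousAddEquiv.toIntEnd (α : G ≃ₜ+ G) : Module.End ℤ G :=
  (α : G →+ G).toIntLinearMap

@[simp]
theorem ContinuousAddEquiv.toIntEnd_apply (α : G ≃ₜ+ G) (x : G) : α.toIntEnd x = α x := rfl

theorem ContinuousAddEquiv.toIntEnd_pow_apply (α : G ≃ₜ+ G) (n : ℕ) (x : G) :
    (α.toIntEnd ^ n) x = (α : G → G)^[n] x := by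
  rw [Module.End.pow_apply]; rfl

/-- The polynomial `p` in the automorphism `α`, evaluated at `x`. -/
noncomputable def polyAct (α : G ≃ₜ+ G) (p : Polynomial ℤ) (x : G) : G :=
  Polynomial.aeval α.toIntEnd p x

variable {α : G ≃ₜ+ G}

theorem polyAct_add (p q : Polynomial ℤ) (x : G) :
    polyAct α (p + q) x = polyAct α p x + polyAct α q x := by simp [polyAct]

theorem polyAct_sub (p q : Polynomial ℤ) (x : G) :
    polyAct α (p - q) x = polyAct α p x - polyAct α q x := by simp [polyAct]

theorem polyAct_mul (p q : Polynomial ℤ) (x : G) :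
    polyAct α (p * q) x = polyAct α p (polyAct α q x) := by simp [polyAct]

theorem polyAct_add_right (p : Polynomial ℤ) (x y : G) :
    polyAct α p (x + y) = polyAct α p x + polyAct α p y := by simp [polyAct]

theorem polyAct_sub_right (p : Polynomial ℤ) (x y : G) :
    polyAct α p (x - y) = polyAct α p x - polyAct α p y := by simp [polyAct]

@[simp]
theorem polyAct_zero (x : G) : polyAct α 0 x = 0 := by simp [polyAct]

@[simp]
theorem polyAct_zero_right (p : Polynomial ℤ) : polyAct α p 0 = 0 := by simp [polyAct]

@[simp]
theorem polyAct_one (x : G) : polyAct α 1 x = x := by simp [polyAct]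

@[simp]
theorem polyAct_X (x : G) : polyAct α Polynomial.X x = α x := by simp [polyAct]

theorem polyAct_X_pow (n : ℕ) (x : G) :
    polyAct α (Polynomial.X ^ n) x = (α : G → G)^[n] x := by
  simp [polyAct, ContinuousAddEquiv.toIntEnd_pow_apply]

theorem polyAct_trunc_succ (f : ℤ⟦X⟧) (n : ℕ) (x : G) :
    polyAct α (trunc (n + 1) f) x =
      polyAct α (trunc n f) x + PowerSeries.coeff n f • (α : G → G)^[n] x := by
  rw [PowerSeries.trunc_succ, polyAct_add]
  simp [polyAct, ContinuousAddEquiv.toIntEnd_pow_apply]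

theorem polyAct_equivariant {H : Type v} [AddCommGroup H] [TopologicalSpace H] {β : H ≃ₜ+ H}
    (φ : G →+ H) (hφ : ∀ x, φ (α x) = β (φ x)) (p : Polynomial ℤ) (x : G) :
    φ (polyAct α p x) = polyAct β p (φ x) := by
  induction p using Polynomial.induction_on' with
  | add p q hp hq => rw [polyAct_add, polyAct_add, map_add, hp, hq]
  | monomial n c =>
    have : ∀ n : ℕ, φ ((α : G → G)^[n] x) = (β : H → H)^[n] (φ x) := fun n => by
      induction n with
      | zero => rfl
      | succ n ih => rw [Function.iterate_succ_apply', Function.iterate_succ_apply', hφ, ih]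
    simp [polyAct, ContinuousAddEquiv.toIntEnd_pow_apply, this]

namespace IsContractionLattice

variable {W : AddSubgroup G} (hW : IsContractionLattice α W)

include hW

theorem isClosed [IsTopologicalAddGroup G] : IsClosed (W : Set G) :=
  W.isClosed_of_isOpen hW.isOpen

theorem iterate_mem {x : G} (hx : x ∈ W) (n : ℕ) : (α : G → G)^[n] x ∈ W := by
  induction n with
  | zero => exact hx
  | succ n ih => rw [Function.iterate_succ_apply']; exact hW.map_mem _ ih

theorem polyAct_mem (p : Polynomial ℤ) {x : G} (hx : x ∈ W) : polyAct α p x ∈ W := by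
  induction p using Polynomial.induction_on' with
  | add p q hp hq => rw [polyAct_add]; exact W.add_mem hp hq
  | monomial n c =>
    simp only [polyAct, Polynomial.aeval_monomial, eq_intCast, Module.End.mul_apply,
      ContinuousAddEquiv.toIntEnd_pow_apply, Module.End.intCast_apply]
    exact W.zsmul_mem (hW.iterate_mem hx n) c

theorem exists_iterate_mem_lattice
    (hc : ∀ x : G, Tendsto (fun k : ℕ => (α : G → G)^[k] x) atTop (𝓝 0)) (x : G) :
    ∃ k, (α : G → G)^[k] x ∈ W :=
  ((hc x).eventually_mem (hW.isOpen.mem_nhds W.zero_mem)).exists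

/-- The elements `X ^ n * p` act by small endomorphisms, when `n` is large. -/
theorem exists_polyAct_X_pow_mul_mem
    (hc : ∀ x : G, Tendsto (fun k : ℕ => (α : G → G)^[k] x) atTop (𝓝 0)) (x : G)
    {U : Set G} (hU : U ∈ 𝓝 0) :
    ∃ N : ℕ, ∀ n ≥ N, ∀ p, polyAct α (Polynomial.X ^ n * p) x ∈ U := by
  obtain ⟨j, hj⟩ := hW.exists_iterate_mem_lattice hc x
  obtain ⟨N, hN⟩ := hW.exists_iterate_mem U hU
  refine ⟨N + j, fun n hn p => ?_⟩
  obtain ⟨m, rfl⟩ := Nat.exists_eq_add_of_le hn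
  have : Polynomial.X ^ (N + j + m) * p = Polynomial.X ^ (N + m) * (p * Polynomial.X ^ j) := by
    ring
  rw [this, polyAct_mul, polyAct_X_pow, polyAct_mul, polyAct_X_pow]
  exact hN _ (by omega) _ (hW.polyAct_mem p hj)

/-- The endomorphisms `polyAct α p` are equicontinuous. -/
theorem exists_mem_nhds_polyAct_mem {U : Set G} (hU : U ∈ 𝓝 0) :
    ∃ V ∈ 𝓝 (0 : G), ∀ p, ∀ v ∈ V, polyAct α p v ∈ U := by
  obtain ⟨N, hN⟩ := hW.exists_iterate_mem U hU
  refine ⟨(α.symm : G → G)^[N] ⁻¹' W, ?_, fun p v hv => ?_⟩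
  · refine (α.symm.continuous_toFun.iterate N).continuousAt.preimage_mem_nhds ?_
    change (W : Set G) ∈ 𝓝 ((α.symm : G → G)^[N] 0)
    rw [iterate_map_zero]
    exact hW.isOpen.mem_nhds W.zero_mem
  · have hl : Function.LeftInverse (α : G → G) α.symm := α.apply_symm_apply
    -- Polynomials in `α` commute with `α^N` and preserve `W`, so all of them map `α^N W` into
    -- itself.
    have : polyAct α p v = (α : G → G)^[N] (polyAct α p ((α.symm : G → G)^[N] v)) := by
      rw [← polyAct_X_pow, ← polyAct_mul, mul_comm, polyAct_mul, polyAct_X_pow,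
        (hl.iterate N) v]
    rw [this]
    exact hN N le_rfl _ (hW.polyAct_mem p hv)

end IsContractionLattice

namespace IsLCATorsionContractionGroup

/-- Late truncations differ by a multiple of a high power of `X`, which acts on `x` with small
values whatever the cofactor. Thus the values are Cauchy, and a locally compact group is complete.
-/
theorem exists_tendsto_polyAct_trunc (h : IsLCATorsionContractionGroup G α) (f : ℤ⟦X⟧) (x : G) :
    ∃ y, Tendsto (fun n => polyAct α (trunc n f) x) atTop (𝓝 y) := by
  have := h.isTopologicalAddGroup
  have := h.locallyCompactSpace
  obtain ⟨W, hW⟩ := h.exists_isContractionLattice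
  let : UniformSpace G := IsTopologicalAddGroup.rightUniformSpace G
  have : IsUniformAddGroup G := isUniformAddGroup_of_addCommGroup
  have : CompleteSpace G := IsRightUniformAddGroup.completeSpace_of_weaklyLocallyCompactSpace
  apply cauchySeq_tendsto_of_complete
  rw [cauchySeq_iff, uniformity_eq_comap_nhds_zero G]
  rintro V ⟨U, hU, hUV⟩
  obtain ⟨N, hN⟩ := hW.exists_polyAct_X_pow_mul_mem h.contractive x hU
  refine ⟨N, fun m hm n hn => hUV ?_⟩
  obtain ⟨q, hq⟩ : Polynomial.X ^ N ∣ trunc n f - trunc m f := by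
    rw [Polynomial.X_pow_dvd_iff]
    intro d hd
    rw [Polynomial.coeff_sub, PowerSeries.coeff_trunc, PowerSeries.coeff_trunc,
      if_pos (by omega), if_pos (by omega), sub_self]
  change polyAct α (trunc n f) x - polyAct α (trunc m f) x ∈ U
  rw [← polyAct_sub, hq]
  exact hN N le_rfl q

/-- This is associativity of the action. Two errors tend to zero: the one from replacing `y` by its
approximants, by equicontinuity, and the one from truncating the product, a multiple of `X^n`. -/
theorem tendsto_polyAct_trunc_mul (h : IsLCATorsionContractionGroup G α) {f g : ℤ⟦X⟧} {x y z : G}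
    (hy : Tendsto (fun n => polyAct α (trunc n g) x) atTop (𝓝 y))
    (hz : Tendsto (fun n => polyAct α (trunc n f) y) atTop (𝓝 z)) :
    Tendsto (fun n => polyAct α (trunc n (f * g)) x) atTop (𝓝 z) := by
  have := h.isTopologicalAddGroup
  obtain ⟨W, hW⟩ := h.exists_isContractionLattice
  have h₁ : Tendsto (fun n => polyAct α (trunc n f) (polyAct α (trunc n g) x - y)) atTop
      (𝓝 0) := by
    intro U hU
    obtain ⟨V, hV, hVU⟩ := hW.exists_mem_nhds_polyAct_mem hU
    have : Tendsto (fun n => polyAct α (trunc n g) x - y) atTop (𝓝 0) := by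
      simpa using hy.sub_const y
    rw [mem_map]
    filter_upwards [this hV] with n hn using hVU _ _ hn
  have h₂ : Tendsto (fun n => polyAct α (trunc n (f * g) - trunc n f * trunc n g) x) atTop
      (𝓝 0) := by
    intro U hU
    obtain ⟨N, hN⟩ := hW.exists_polyAct_X_pow_mul_mem h.contractive x hU
    rw [mem_map]
    filter_upwards [eventually_ge_atTop N] with n hn
    obtain ⟨q, hq⟩ : Polynomial.X ^ n ∣ trunc n (f * g) - trunc n f * trunc n g := by
      rw [Polynomial.X_pow_dvd_iff]
      intro d hd
      have := congrArg (fun p => Polynomial.coeff p d)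
        (PowerSeries.trunc_trunc_mul_trunc (n := n) f g)
      simp only [PowerSeries.coeff_trunc, if_pos hd] at this
      rw [Polynomial.coeff_sub, PowerSeries.coeff_trunc, if_pos hd, ← this, ← Polynomial.coe_mul,
        Polynomial.coeff_coe, sub_self]
    rw [Set.mem_preimage, hq]
    exact hN n hn q
  have h₃ := (h₁.add h₂).add hz
  rw [add_zero, zero_add] at h₃
  refine h₃.congr fun n => ?_
  rw [polyAct_sub_right, polyAct_sub, polyAct_mul]
  abel

/-- The action of the power series ring on a contraction group in which `X` acts by the
contraction. -/
@[reducible]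
noncomputable def powerSeriesModule (h : IsLCATorsionContractionGroup G α) : Module ℤ⟦X⟧ G :=
  have := h.isTopologicalAddGroup
  have := h.t2Space
  have spec (f : ℤ⟦X⟧) (x : G) := Classical.choose_spec (h.exists_tendsto_polyAct_trunc f x)
  { smul := fun f x => Classical.choose (h.exists_tendsto_polyAct_trunc f x)
    one_smul := fun x => tendsto_nhds_unique (spec 1 x) <| by
      refine tendsto_const_nhds.congr' ?_
      filter_upwards [eventually_ge_atTop 1] with n hn
      obtain ⟨n, rfl⟩ := Nat.exists_eq_add_of_le' hn
      simp
    mul_smul := fun f g x => tendsto_nhds_unique (spec (f * g) x)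
      (h.tendsto_polyAct_trunc_mul (spec g x) (spec f _))
    smul_zero := fun f => tendsto_nhds_unique (spec f 0) (by simp)
    smul_add := fun f x y => tendsto_nhds_unique (spec f (x + y)) <| by
      simp only [polyAct_add_right]
      exact (spec f x).add (spec f y)
    add_smul := fun f g x => tendsto_nhds_unique (spec (f + g) x) <| by
      simp only [map_add, polyAct_add]
      exact (spec f x).add (spec g x)
    zero_smul := fun x => tendsto_nhds_unique (spec 0 x) (by simp) }

end IsLCATorsionContractionGroup

/-- Power series act on `G` as power series in the automorphism `α`. -/
def IsPowerSeriesAction (α : G ≃ₜ+ G) [Module ℤ⟦X⟧ G] : Prop :=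
  ∀ (f : ℤ⟦X⟧) (x : G), Tendsto (fun n => polyAct α (trunc n f) x) atTop (𝓝 (f • x))

theorem IsLCATorsionContractionGroup.isPowerSeriesAction (h : IsLCATorsionContractionGroup G α) :
    letI := h.powerSeriesModule
    IsPowerSeriesAction α := fun f x =>
  Classical.choose_spec (h.exists_tendsto_polyAct_trunc f x)

namespace IsPowerSeriesAction

variable [Module ℤ⟦X⟧ G] (hm : IsPowerSeriesAction α)

include hm

theorem X_smul [T2Space G] (x : G) : (PowerSeries.X : ℤ⟦X⟧) • x = α x := by
  refine tendsto_nhds_unique (hm _ x) (tendsto_const_nhds.congr' ?_)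
  filter_upwards [eventually_ge_atTop 2] with n hn
  rw [PowerSeries.trunc_X_of hn, polyAct_X]

theorem X_pow_smul [T2Space G] (n : ℕ) (x : G) :
    (PowerSeries.X : ℤ⟦X⟧) ^ n • x = (α : G → G)^[n] x := by
  induction n with
  | zero => simp
  | succ n ih => rw [pow_succ', mul_smul, ih, hm.X_smul, Function.iterate_succ_apply']

theorem smul_mem_lattice [IsTopologicalAddGroup G] {W : AddSubgroup G}
    (hW : IsContractionLattice α W) (f : ℤ⟦X⟧) {x : G} (hx : x ∈ W) : f • x ∈ W :=
  hW.isClosed.mem_of_tendsto (hm f x) (Eventually.of_forall fun _ => hW.polyAct_mem _ hx)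

/-- The lattice is finitely generated over the power series ring. -/
theorem exists_finset_lattice_le_span [IsTopologicalAddGroup G] [T2Space G] {W : AddSubgroup G}
    (hW : IsContractionLattice α W) :
    ∃ F : Finset G, ∀ x ∈ W, x ∈ Submodule.span ℤ⟦X⟧ (F : Set G) := by
  classical
  obtain ⟨F, hFW, hF⟩ := hW.isCompact.elim_nhds_subcover
    (fun x => (fun y => α.symm (y - x)) ⁻¹' W) (fun x _ => by
      refine ContinuousAt.preimage_mem_nhds
        (α.symm.continuous_toFun.comp (continuous_id.sub continuous_const)).continuousAt ?_
      simpa using hW.isOpen.mem_nhds W.zero_mem)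
  have hdigit : ∀ w : W, ∃ (f : F) (w' : W), (w : G) = f + α w' := by
    rintro ⟨w, hw⟩
    obtain ⟨f, hf, hfw⟩ := Set.mem_iUnion₂.1 (hF hw)
    -- Finitely many cosets `f + α W` cover `W`, so each `w` has a digit `f` and a remainder in `W`.
    exact ⟨⟨f, hf⟩, ⟨_, hfw⟩, by simp⟩
  choose d r hdr using hdigit
  refine ⟨F, fun x hx => ?_⟩
  let w : ℕ → W := fun n => r^[n] ⟨x, hx⟩
  -- The series `g f` marks the places at which the digit of `x` is `f`.
  let g : G → ℤ⟦X⟧ := fun f => PowerSeries.mk fun n => if (d (w n) : G) = f then 1 else 0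
  have hpart : ∀ n, x = ∑ f ∈ F, polyAct α (trunc n (g f)) f + (α : G → G)^[n] (w n) := by
    intro n
    induction n with
    | zero => simp [w]
    | succ n ih =>
      have hw : w (n + 1) = r (w n) := Function.iterate_succ_apply' _ _ _
      have hs : ∑ f ∈ F, PowerSeries.coeff n (g f) • (α : G → G)^[n] f =
          (α : G → G)^[n] (d (w n)) := by
        simp only [g, PowerSeries.coeff_mk, ite_smul, one_smul, zero_smul]
        rw [Finset.sum_ite_eq, if_pos (d (w n)).2]
      simp only [polyAct_trunc_succ, Finset.sum_add_distrib]
      rw [hs, hw, Function.iterate_succ_apply, add_assoc, ← iterate_map_add, ← hdr]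
      exact ih
  have hlim : Tendsto (fun n => ∑ f ∈ F, polyAct α (trunc n (g f)) f) atTop
      (𝓝 (∑ f ∈ F, g f • f)) := tendsto_finsetSum _ fun f _ => hm (g f) f
  have hzero : Tendsto (fun n => (α : G → G)^[n] (w n)) atTop (𝓝 0) := by
    intro U hU
    obtain ⟨N, hN⟩ := hW.exists_iterate_mem U hU
    rw [mem_map]
    filter_upwards [eventually_ge_atTop N] with n hn using hN n hn _ (w n).2
  have hx' : x = ∑ f ∈ F, g f • f := by
    have := hlim.add hzero
    rw [add_zero] at this
    exact tendsto_nhds_unique (tendsto_const_nhds.congr fun n => hpart n) this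
  rw [hx']
  exact Submodule.sum_mem _ fun f hf =>
    Submodule.smul_mem _ _ (Submodule.subset_span hf)

/-- A linear map for the power series actions is continuous. -/
theorem continuous_linearMap {H : Type v} [AddCommGroup H] [TopologicalSpace H] [Module ℤ⟦X⟧ H]
    {β : H ≃ₜ+ H} (hG : IsLCATorsionContractionGroup G α) (hH : IsLCATorsionContractionGroup H β)
    (hm' : IsPowerSeriesAction β) (φ : G →ₗ[ℤ⟦X⟧] H) : Continuous φ := by
  have := hG.isTopologicalAddGroup
  have := hH.isTopologicalAddGroup
  have := hG.t2Space
  have := hH.t2Space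
  obtain ⟨W, hW⟩ := hG.exists_isContractionLattice
  obtain ⟨W', hW'⟩ := hH.exists_isContractionLattice
  obtain ⟨F, hF⟩ := hm.exists_finset_lattice_le_span hW
  have hFe : ∀ᶠ k in atTop, ∀ f ∈ F, (β : H → H)^[k] (φ f) ∈ (W' : Set H) :=
    (eventually_all_finset F).2 fun f _ =>
      (hH.contractive (φ f)).eventually_mem (hW'.isOpen.mem_nhds W'.zero_mem)
  obtain ⟨k, hk⟩ := hFe.exists
  -- It suffices that `X^k` carries the images of the finitely many generators into `W'`, since `W'`
  -- is stable under power series.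
  have hWW' : ∀ x ∈ W, (PowerSeries.X : ℤ⟦X⟧) ^ k • φ x ∈ W' := by
    intro x hx
    replace hx := hF x hx
    induction hx using Submodule.span_induction with
    | mem x h => rw [hm'.X_pow_smul]; exact hk x h
    | zero => rw [map_zero, smul_zero]; exact W'.zero_mem
    | add x y _ _ hx hy => rw [map_add, smul_add]; exact W'.add_mem hx hy
    | smul a x _ hx => rw [map_smul, smul_comm]; exact hm'.smul_mem_lattice hW' a hx
  refine continuous_of_continuousAt_zero φ.toAddMonoidHom fun U hU => ?_
  change U ∈ 𝓝 (φ 0) at hU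
  rw [map_zero] at hU
  obtain ⟨N, hN⟩ := hW'.exists_iterate_mem U hU
  rw [mem_map]
  -- This neighbourhood is `α^(N + k) W`; `φ` maps it into `β^N W'`, which lies in `U`.
  have hV : (α.symm : G → G)^[N + k] ⁻¹' W ∈ 𝓝 (0 : G) := by
    refine (α.symm.continuous_toFun.iterate (N + k)).continuousAt.preimage_mem_nhds ?_
    change (W : Set G) ∈ 𝓝 ((α.symm : G → G)^[N + k] 0)
    rw [iterate_map_zero]
    exact hW.isOpen.mem_nhds W.zero_mem
  filter_upwards [hV] with x hx
  have hl : Function.LeftInverse (α : G → G) α.symm := α.apply_symm_apply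
  have hxe : x = (PowerSeries.X : ℤ⟦X⟧) ^ (N + k) • (α.symm : G → G)^[N + k] x := by
    rw [hm.X_pow_smul, (hl.iterate (N + k)) x]
  change φ x ∈ U
  rw [hxe, map_smul, pow_add, mul_smul, hm'.X_pow_smul]
  exact hN N le_rfl _ (hWW' _ hx)

/-- A linear equivalence for the power series actions is an isomorphism of contraction groups. -/
theorem contractionIso_of_linearEquiv {H : Type v} [AddCommGroup H] [TopologicalSpace H]
    [Module ℤ⟦X⟧ H] {β : H ≃ₜ+ H} (hG : IsLCATorsionContractionGroup G α)
    (hH : IsLCATorsionContractionGroup H β) (hm' : IsPowerSeriesAction β) (φ : G ≃ₗ[ℤ⟦X⟧] H) :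
    ContractionIso α β := by
  have := hG.t2Space
  have := hH.t2Space
  refine ⟨{ φ.toAddEquiv with
    continuous_toFun := hm.continuous_linearMap hG hH hm' φ
    continuous_invFun := hm'.continuous_linearMap hH hG hm φ.symm }, fun x => ?_⟩
  change φ (α x) = β (φ x)
  rw [← hm.X_smul, map_smul, hm'.X_smul]

end IsPowerSeriesAction

end PowerSeriesAction

/-! ### Modules of prime power exponent and localization at `(p)`. -/

section PrimePower

theorem PowerSeries.natCast_dvd_iff (n : ℕ) (f : ℤ⟦X⟧) :
    (n : ℤ⟦X⟧) ∣ f ↔ ∀ i, (n : ℤ) ∣ PowerSeries.coeff i f := by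
  have hn : (n : ℤ⟦X⟧) = PowerSeries.C (n : ℤ) := by simp
  rw [hn]
  constructor
  · rintro ⟨g, rfl⟩ i
    rw [PowerSeries.coeff_C_mul]
    exact dvd_mul_right _ _
  · intro h
    choose g hg using h
    exact ⟨PowerSeries.mk g, PowerSeries.ext fun i => by
      rw [PowerSeries.coeff_C_mul, PowerSeries.coeff_mk, hg]⟩

theorem PowerSeries.natCast_dvd_iff_map_eq_zero (n : ℕ) (f : ℤ⟦X⟧) :
    (n : ℤ⟦X⟧) ∣ f ↔ PowerSeries.map (Int.castRingHom (ZMod n)) f = 0 := by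
  rw [PowerSeries.natCast_dvd_iff, PowerSeries.ext_iff]
  simp [ZMod.intCast_zmod_eq_zero_iff_dvd]

variable (p : ℕ) [hp : Fact p.Prime]

theorem PowerSeries.prime_natCast : Prime (p : ℤ⟦X⟧) := by
  refine ⟨fun h => ?_, fun h => ?_, fun f g h => ?_⟩
  · have := congrArg (PowerSeries.coeff 0) h
    rw [← map_natCast (PowerSeries.C (R := ℤ)), PowerSeries.coeff_zero_C] at this
    exact hp.out.ne_zero (by simpa using this)
  · have := (PowerSeries.natCast_dvd_iff_map_eq_zero p 1).1 (isUnit_iff_dvd_one.1 h)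
    simp at this
  · rw [PowerSeries.natCast_dvd_iff_map_eq_zero, map_mul, mul_eq_zero] at h
    simpa only [PowerSeries.natCast_dvd_iff_map_eq_zero] using h

/-- The prime ideal generated by `p` in the power series ring over the integers. -/
noncomputable abbrev primeIdeal : Ideal ℤ⟦X⟧ := Ideal.span {(p : ℤ⟦X⟧)}

instance primeIdeal.isPrime : (primeIdeal p).IsPrime :=
  (Ideal.span_singleton_prime (PowerSeries.prime_natCast p).ne_zero).2
    (PowerSeries.prime_natCast p)

theorem PowerSeries.X_pow_mem_primeCompl (k : ℕ) :
    (PowerSeries.X : ℤ⟦X⟧) ^ k ∈ (primeIdeal p).primeCompl := by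
  intro h
  have h := (Ideal.mem_span_singleton.1 ((primeIdeal.isPrime p).mem_of_pow_mem k h))
  rw [PowerSeries.natCast_dvd_iff_map_eq_zero, PowerSeries.map_X] at h
  exact PowerSeries.X_ne_zero h

/-- The localization of the power series ring at the prime `p`. -/
abbrev LocRing : Type := Localization.AtPrime (primeIdeal p)

/-- The ring is a Noetherian local domain, not a field, whose maximal ideal is generated by `p`. -/
instance LocRing.isDiscreteValuationRing : IsDiscreteValuationRing (LocRing p) := by
  have hmax : IsLocalRing.maximalIdeal (LocRing p) = Ideal.span {(p : LocRing p)} := by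
    rw [← Localization.AtPrime.map_eq_maximalIdeal, Ideal.map_span, Set.image_singleton,
      map_natCast]
  have hne : (p : LocRing p) ≠ 0 := by
    have := (IsLocalization.injective (LocRing p)
      (primeIdeal p).primeCompl_le_nonZeroDivisors).ne (PowerSeries.prime_natCast p).ne_zero
    simpa using this
  have hnf : ¬ IsField (LocRing p) := by
    rw [IsLocalRing.isField_iff_maximalIdeal_eq, hmax]
    simpa using hne
  have hnoeth : IsNoetherianRing (LocRing p) :=
    IsLocalization.isNoetherianRing (primeIdeal p).primeCompl _ inferInstance
  have := ((IsDiscreteValuationRing.TFAE (LocRing p) hnf).out 0 4).2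
  exact this ⟨⟨(p : LocRing p), hmax⟩⟩

theorem LocRing.irreducible_natCast : Irreducible (p : LocRing p) := by
  rw [IsDiscreteValuationRing.irreducible_iff_uniformizer,
    ← Localization.AtPrime.map_eq_maximalIdeal, Ideal.map_span, Set.image_singleton,
      map_natCast]

variable {p}

/-- A power series which is not divisible by `p` acts invertibly on modules of `p`-power exponent
on which `X` is invertible. -/
theorem isUnit_algebraMap_end_of_notMem_primeIdeal {M : Type*} [AddCommGroup M] [Module ℤ⟦X⟧ M]
    {e : ℕ} (he : ∀ x : M, ((p : ℤ⟦X⟧) ^ e) • x = 0)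
    (hX : Function.Bijective fun x : M => (PowerSeries.X : ℤ⟦X⟧) • x)
    {s : ℤ⟦X⟧} (hs : s ∈ (primeIdeal p).primeCompl) :
    IsUnit (algebraMap ℤ⟦X⟧ (Module.End ℤ⟦X⟧ M) s) := by
  have hXu : IsUnit (algebraMap ℤ⟦X⟧ (Module.End ℤ⟦X⟧ M) PowerSeries.X) := by
    rw [Module.End.isUnit_iff]
    exact hX
  have hpn : IsNilpotent (algebraMap ℤ⟦X⟧ (Module.End ℤ⟦X⟧ M) (p : ℤ⟦X⟧)) :=
    ⟨e, by rw [← map_pow]; exact LinearMap.ext fun x => he x⟩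
  have hs0 : PowerSeries.map (Int.castRingHom (ZMod p)) s ≠ 0 := fun h =>
    hs (Ideal.mem_span_singleton.2 ((PowerSeries.natCast_dvd_iff_map_eq_zero p s).2 h))
  -- Over the field `ZMod p` a nonzero series is a unit times a power of `X`. Lifting the inverse
  -- unit to `g` gives `g * s = X^k + p * h`, which acts as an invertible plus a commuting nilpotent
  -- endomorphism.
  obtain ⟨k, u, hu⟩ : ∃ (k : ℕ) (u : (ZMod p)⟦X⟧), u * PowerSeries.map (Int.castRingHom (ZMod p)) s =
      PowerSeries.X ^ k := by
    obtain ⟨k, u, hu⟩ := IsDiscreteValuationRing.eq_unit_mul_pow_irreducible hs0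
      (PowerSeries.X_prime (R := ZMod p)).irreducible
    exact ⟨k, ↑u⁻¹, by rw [hu, ← mul_assoc, Units.inv_mul, one_mul]⟩
  obtain ⟨g, rfl⟩ := PowerSeries.map_surjective (Int.castRingHom (ZMod p))
    (ZMod.ringHom_surjective _) u
  obtain ⟨h, hh⟩ : (p : ℤ⟦X⟧) ∣ g * s - PowerSeries.X ^ k := by
    rw [PowerSeries.natCast_dvd_iff_map_eq_zero, map_sub, map_mul, map_pow, PowerSeries.map_X, hu,
      sub_self]
  have hgs : IsUnit (algebraMap ℤ⟦X⟧ (Module.End ℤ⟦X⟧ M) (g * s)) := by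
    rw [sub_eq_iff_eq_add.1 hh, map_add, map_mul, map_pow, add_comm]
    refine IsNilpotent.isUnit_add_left_of_commute ?_ (hXu.pow k) ?_
    · exact Commute.isNilpotent_mul_right (Algebra.commutes _ _) hpn
    · rw [← map_pow, ← map_mul]
      exact (Algebra.commutes _ _).symm
  rw [map_mul] at hgs
  have hcomm : Commute (algebraMap ℤ⟦X⟧ (Module.End ℤ⟦X⟧ M) g)
    (algebraMap ℤ⟦X⟧ (Module.End ℤ⟦X⟧ M) s) := Algebra.commutes _ _
  exact (hcomm.isUnit_mul_iff.1 hgs).2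

/-- Such a module is its own localization, which is how it acquires an action of `LocRing p`. -/
theorem isLocalizedModule_id_of_bijective_X_smul {M : Type*} [AddCommGroup M] [Module ℤ⟦X⟧ M]
    {e : ℕ} (he : ∀ x : M, ((p : ℤ⟦X⟧) ^ e) • x = 0)
    (hX : Function.Bijective fun x : M => (PowerSeries.X : ℤ⟦X⟧) • x) :
    IsLocalizedModule (primeIdeal p).primeCompl (LinearMap.id : M →ₗ[ℤ⟦X⟧] M) :=
  ⟨fun s => isUnit_algebraMap_end_of_notMem_primeIdeal he hX s.2,
    fun y => ⟨(y, 1), by simp⟩, fun h => ⟨1, by simpa using h⟩⟩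

/-- The module `T` has the structure of the localization of `ℤ⟦X⟧ ⧸ (q)` at the powers of `X`, with
generator `e`. -/
structure IsCyclicModel (q : ℕ) (T : Type*) [AddCommGroup T] [Module ℤ⟦X⟧ T] (e : T) : Prop where
  X_bijective : Function.Bijective fun x : T => (PowerSeries.X : ℤ⟦X⟧) • x
  smul_eq_zero_iff : ∀ f : ℤ⟦X⟧, f • e = 0 ↔ (q : ℤ⟦X⟧) ∣ f
  exists_X_pow_smul : ∀ x : T, ∃ (k : ℕ) (f : ℤ⟦X⟧), (PowerSeries.X : ℤ⟦X⟧) ^ k • x = f • e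

theorem IsCyclicModel.q_smul {q : ℕ} {T : Type*} [AddCommGroup T] [Module ℤ⟦X⟧ T] {e : T}
    (h : IsCyclicModel q T e) (x : T) : (q : ℤ⟦X⟧) • x = 0 := by
  obtain ⟨k, f, hf⟩ := h.exists_X_pow_smul x
  have : (PowerSeries.X : ℤ⟦X⟧) ^ k • (q : ℤ⟦X⟧) • x = 0 := by
    rw [smul_comm, hf, ← mul_smul, h.smul_eq_zero_iff]
    exact dvd_mul_right _ _
  clear hf
  induction k with
  | zero => simpa using this
  | succ k ih =>
    rw [pow_succ', mul_smul] at this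
    exact ih (h.X_bijective.1 (this.trans (smul_zero _).symm))

/-- The map `r ↦ r • e` is onto because powers of `X` are denominators; clearing denominators
reduces its kernel to the annihilator of `e` in `ℤ⟦X⟧`, generated by `p^k`. -/
theorem IsCyclicModel.nonempty_linearEquiv {k : ℕ} {T : Type*} [AddCommGroup T] [Module ℤ⟦X⟧ T]
    {e : T} (h : IsCyclicModel (p ^ k) T e) :
    Nonempty ((LocRing p ⧸ LocRing p ∙ (p : LocRing p) ^ k) ≃ₗ[ℤ⟦X⟧] T) := by
  have hq : ∀ x : T, ((p : ℤ⟦X⟧) ^ k) • x = 0 := fun x => by simpa using h.q_smul x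
  have hloc := isLocalizedModule_id_of_bijective_X_smul hq h.X_bijective
  let _ : Module (LocRing p) T := IsLocalizedModule.module (primeIdeal p).primeCompl LinearMap.id
  have : IsScalarTower ℤ⟦X⟧ (LocRing p) T :=
    IsLocalizedModule.isScalarTower_module (primeIdeal p).primeCompl LinearMap.id
  have hinj : ∀ (s : (primeIdeal p).primeCompl) {x y : T},
      (s : ℤ⟦X⟧) • x = (s : ℤ⟦X⟧) • y → x = y := fun s x y hxy =>
    IsLocalizedModule.smul_injective (LinearMap.id : T →ₗ[ℤ⟦X⟧] T) s hxy
  have hmk : ∀ (f : ℤ⟦X⟧) (s : (primeIdeal p).primeCompl) (x : T),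
      (s : ℤ⟦X⟧) • (IsLocalization.mk' (LocRing p) f s) • x = f • x := fun f s x => by
    rw [← smul_assoc, Algebra.smul_def, IsLocalization.mk'_spec', algebraMap_smul]
  let φ : LocRing p →ₗ[LocRing p] T := LinearMap.toSpanSingleton (LocRing p) T e
  have hsurj : Function.Surjective φ := fun x => by
    obtain ⟨j, f, hf⟩ := h.exists_X_pow_smul x
    let s : (primeIdeal p).primeCompl := ⟨_, PowerSeries.X_pow_mem_primeCompl p j⟩
    refine ⟨IsLocalization.mk' (LocRing p) f s, hinj s ?_⟩
    rw [LinearMap.toSpanSingleton_apply, hmk]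
    exact hf.symm
  have hker : LinearMap.ker φ = LocRing p ∙ (p : LocRing p) ^ k := by
    ext r
    rw [LinearMap.mem_ker, LinearMap.toSpanSingleton_apply, Ideal.submodule_span_eq,
      Ideal.mem_span_singleton]
    constructor
    · intro hr
      obtain ⟨f, s, rfl⟩ := IsLocalization.exists_mk'_eq (primeIdeal p).primeCompl r
      have hf := hmk f s e
      rw [hr, smul_zero, eq_comm, h.smul_eq_zero_iff] at hf
      obtain ⟨g, rfl⟩ := hf
      refine ⟨IsLocalization.mk' (LocRing p) g s, ?_⟩
      rw [← IsLocalization.mul_mk'_eq_mk'_of_mul, Nat.cast_pow, map_pow, map_natCast]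
    · rintro ⟨r', rfl⟩
      have hpk : (p : LocRing p) ^ k = algebraMap ℤ⟦X⟧ (LocRing p) ((p : ℤ⟦X⟧) ^ k) := by simp
      rw [mul_smul, hpk, algebraMap_smul, hq]
  exact ⟨((Submodule.quotEquivOfEq _ _ hker.symm).trans
    (φ.quotKerEquivOfSurjective hsurj)).restrictScalars ℤ⟦X⟧⟩

/-- A module of `p`-power exponent over the power series ring, on which `X` is invertible, and
which is finitely generated up to powers of `X`, is a product of cyclic modules over the
localization. -/
theorem exists_linearEquiv_pi_of_pow_smul_eq_zero {M : Type v} [AddCommGroup M] [Module ℤ⟦X⟧ M]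
    {e : ℕ} (he : ∀ x : M, ((p : ℤ⟦X⟧) ^ e) • x = 0)
    (hX : Function.Bijective fun x : M => (PowerSeries.X : ℤ⟦X⟧) • x)
    (F : Finset M)
    (hF : ∀ x : M, ∃ k : ℕ, (PowerSeries.X : ℤ⟦X⟧) ^ k • x ∈ Submodule.span ℤ⟦X⟧ (F : Set M)) :
    ∃ (d : ℕ) (k : Fin d → ℕ),
      Nonempty (M ≃ₗ[ℤ⟦X⟧] ((i : Fin d) → LocRing p ⧸ LocRing p ∙ (p : LocRing p) ^ k i)) := by
  have hloc := isLocalizedModule_id_of_bijective_X_smul he hX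
  let _ : Module (LocRing p) M := IsLocalizedModule.module (primeIdeal p).primeCompl LinearMap.id
  have : IsScalarTower ℤ⟦X⟧ (LocRing p) M :=
    IsLocalizedModule.isScalarTower_module (primeIdeal p).primeCompl LinearMap.id
  have hfin : Module.Finite (LocRing p) M := by
    refine ⟨F, (Submodule.eq_top_iff'.2 fun x => ?_)⟩
    obtain ⟨k, hk⟩ := hF x
    have hk' : (PowerSeries.X : ℤ⟦X⟧) ^ k • x ∈ Submodule.span (LocRing p) (F : Set M) :=
      Submodule.span_le_restrictScalars ℤ⟦X⟧ (LocRing p) _ hk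
    let s : (primeIdeal p).primeCompl := ⟨_, PowerSeries.X_pow_mem_primeCompl p k⟩
    have := Submodule.smul_mem _ (IsLocalization.mk' (LocRing p) 1 s) hk'
    rwa [← algebraMap_smul (LocRing p) _ x, ← mul_smul, IsLocalization.mk'_spec, map_one,
      one_smul] at this
  have htor : Module.IsTorsion' M (Submonoid.powers (p : LocRing p)) := by
    refine (Submodule.isTorsion'_powers_iff _).2 fun x => ⟨e, ?_⟩
    have hpe : (p : LocRing p) ^ e = algebraMap ℤ⟦X⟧ (LocRing p) ((p : ℤ⟦X⟧) ^ e) := by simp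
    rw [hpe, algebraMap_smul, he]
  obtain ⟨d, k, ⟨φ⟩⟩ :=
    Module.torsion_by_prime_power_decomposition (LocRing.irreducible_natCast p) htor
  exact ⟨d, k, ⟨(φ.trans (DirectSum.linearEquivFunOnFintype _ _ _)).restrictScalars ℤ⟦X⟧⟩⟩

end PrimePower

/-! ### Two-sided sequences as contraction groups and as cyclic modules. -/

namespace TwoSidedPower

variable {F : Type u} [AddCommGroup F]

/-- The entry of a two-sided sequence at a given place. -/
def coord (x : TwoSidedPower F) : ℤ → F
  | Int.ofNat j => x.2 j
  | Int.negSucc k => x.1 k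

theorem ext_coord {x y : TwoSidedPower F} (h : ∀ i, coord x i = coord y i) : x = y :=
  Prod.ext (Finsupp.ext fun k => h (Int.negSucc k)) (funext fun j => h (Int.ofNat j))

@[simp]
theorem coord_add (x y : TwoSidedPower F) (i : ℤ) : coord (x + y) i = coord x i + coord y i := by
  cases i <;> rfl

@[simp]
theorem coord_zero (i : ℤ) : coord (0 : TwoSidedPower F) i = 0 := by
  cases i <;> rfl

theorem coord_sub (x y : TwoSidedPower F) (i : ℤ) : coord (x - y) i = coord x i - coord y i := by
  cases i <;> rfl

theorem coord_nsmul (n : ℕ) (x : TwoSidedPower F) (i : ℤ) : coord (n • x) i = n • coord x i := by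
  induction n with
  | zero => simp
  | succ n ih => rw [succ_nsmul, succ_nsmul, coord_add, ih]

theorem coord_zsmul (n : ℤ) (x : TwoSidedPower F) (i : ℤ) : coord (n • x) i = n • coord x i := by
  cases i <;> rfl

theorem coord_shift (x : TwoSidedPower F) (i : ℤ) : coord (shift F x) i = coord x (i - 1) := by
  match i with
  | Int.ofNat 0 => rfl
  | Int.ofNat (j + 1) =>
    have : Int.ofNat (j + 1) - 1 = Int.ofNat j := by simp
    rw [this]; rfl
  | Int.negSucc k =>
    have : Int.negSucc k - 1 = Int.negSucc (k + 1) := by omega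
    rw [this]; rfl

theorem coord_iterate_shift (n : ℕ) (x : TwoSidedPower F) (i : ℤ) :
    coord ((shift F : TwoSidedPower F → TwoSidedPower F)^[n] x) i = coord x (i - n) := by
  induction n generalizing i with
  | zero => simp
  | succ n ih =>
    rw [Function.iterate_succ_apply', coord_shift, ih]
    congr 1; push_cast; ring

theorem exists_coord_eq_zero (x : TwoSidedPower F) : ∃ N : ℕ, ∀ i : ℤ, i < -N → coord x i = 0 := by
  obtain ⟨N, hN⟩ := x.1.support.bddAbove
  refine ⟨N + 1, fun i hi => ?_⟩
  match i with
  | Int.ofNat j => simp only [Int.ofNat_eq_natCast] at hi; omega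
  | Int.negSucc k =>
    by_contra h
    have := hN (Finset.mem_coe.2 (Finsupp.mem_support_iff.2 h))
    omega

theorem tendsto_of_coord {ι : Type*} {l : Filter ι} {s : ι → TwoSidedPower F} {y : TwoSidedPower F}
    (h₁ : ∀ᶠ n in l, (s n).1 = y.1) (h₂ : ∀ j, ∀ᶠ n in l, (s n).2 j = y.2 j) :
    Tendsto s l (𝓝 y) := by
  let _ : TopologicalSpace F := ⊥
  let _ : TopologicalSpace (ℕ →₀ F) := ⊥
  change Tendsto (fun n => ((s n).1, (s n).2)) l (𝓝 (y.1, y.2))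
  refine Tendsto.prodMk_nhds ?_ (tendsto_pi_nhds.2 fun j => ?_)
  · exact tendsto_const_nhds.congr' (h₁.mono fun n hn => hn.symm)
  · exact tendsto_const_nhds.congr' ((h₂ j).mono fun n hn => hn.symm)

theorem isLCATorsionContractionGroup [Finite F] :
    IsLCATorsionContractionGroup (TwoSidedPower F) (shift F) where
  isTopologicalAddGroup := by
    let _ : TopologicalSpace F := ⊥
    let _ : TopologicalSpace (ℕ →₀ F) := ⊥
    have : DiscreteTopology F := ⟨rfl⟩
    have : DiscreteTopology (ℕ →₀ F) := ⟨rfl⟩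
    exact inferInstanceAs (IsTopologicalAddGroup ((ℕ →₀ F) × (ℕ → F)))
  t2Space := by
    let _ : TopologicalSpace F := ⊥
    let _ : TopologicalSpace (ℕ →₀ F) := ⊥
    have : DiscreteTopology F := ⟨rfl⟩
    have : DiscreteTopology (ℕ →₀ F) := ⟨rfl⟩
    exact inferInstanceAs (T2Space ((ℕ →₀ F) × (ℕ → F)))
  locallyCompactSpace := by
    let _ : TopologicalSpace F := ⊥
    let _ : TopologicalSpace (ℕ →₀ F) := ⊥
    have : DiscreteTopology F := ⟨rfl⟩
    have : DiscreteTopology (ℕ →₀ F) := ⟨rfl⟩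
    exact inferInstanceAs (LocallyCompactSpace ((ℕ →₀ F) × (ℕ → F)))
  isTorsion x := by
    refine isOfFinAddOrder_iff_nsmul_eq_zero.2 ⟨Nat.card F, Nat.card_pos, ext_coord fun i => ?_⟩
    rw [coord_nsmul, coord_zero, card_nsmul_eq_zero']
  contractive x := by
    obtain ⟨N, hN⟩ := exists_coord_eq_zero x
    refine tendsto_of_coord ?_ fun j => ?_
    · filter_upwards [eventually_ge_atTop N] with n hn
      refine Finsupp.ext fun k => ?_
      have := coord_iterate_shift n x (Int.negSucc k)
      rw [hN _ (by omega)] at this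
      exact this
    · filter_upwards [eventually_gt_atTop (N + j)] with n hn
      have := coord_iterate_shift n x (Int.ofNat j)
      rw [hN _ (by simp only [Int.ofNat_eq_natCast]; omega)] at this
      exact this

end TwoSidedPower

namespace LaurentSum

variable (ν : Nat.Primes × ℕ+ →₀ ℕ)

instance neZero_pow (q : Nat.Primes × ℕ+) : NeZero ((q.1 : ℕ) ^ (q.2 : ℕ)) :=
  ⟨pow_ne_zero _ q.1.2.ne_zero⟩

theorem iterate_shift_apply (n : ℕ) (x : LaurentSum ν) (i : SummandIndex ν) :
    (shift ν : LaurentSum ν → LaurentSum ν)^[n] x i =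
      (TwoSidedPower.shift _ : TwoSidedPower (ZMod ((i.1.1 : ℕ) ^ (i.1.2 : ℕ))) → _)^[n] (x i) := by
  induction n with
  | zero => rfl
  | succ n ih => rw [Function.iterate_succ_apply', Function.iterate_succ_apply', ← ih]; rfl

theorem isLCATorsionContractionGroup :
    IsLCATorsionContractionGroup (LaurentSum ν) (shift ν) := by
  have h : ∀ i : SummandIndex ν, IsLCATorsionContractionGroup
      (TwoSidedPower (ZMod ((i.1.1 : ℕ) ^ (i.1.2 : ℕ)))) (TwoSidedPower.shift _) :=
    fun i => TwoSidedPower.isLCATorsionContractionGroup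
  have h₁ := fun i => (h i).isTopologicalAddGroup
  have h₂ := fun i => (h i).t2Space
  have h₃ := fun i => (h i).locallyCompactSpace
  refine ⟨inferInstance, inferInstance, inferInstance, fun x => ?_, fun x => ?_⟩
  · exact IsOfFinAddOrder.pi fun i => (h i).isTorsion (x i)
  · refine tendsto_pi_nhds.2 fun i => ?_
    simp only [iterate_shift_apply]
    exact (h i).contractive (x i)

end LaurentSum

namespace TwoSidedPower

/-- The two-sided sequence with entry `1` at the place `0`. -/
def unitSeq (q : ℕ) : TwoSidedPower (ZMod q) := (0, Pi.single 0 1)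

theorem coord_unitSeq (q : ℕ) (i : ℤ) : coord (unitSeq q) i = if i = 0 then 1 else 0 := by
  match i with
  | Int.ofNat 0 => simp [coord, unitSeq]
  | Int.ofNat (j + 1) =>
    rw [if_neg (by simp only [Int.ofNat_eq_natCast]; omega)]
    simp [coord, unitSeq]
  | Int.negSucc k => rfl

theorem coord_polyAct_trunc_unitSeq (q : ℕ) (f : ℤ⟦X⟧) (n : ℕ) (i : ℤ) :
    coord (polyAct (shift (ZMod q)) (trunc n f) (unitSeq q)) i =
      if 0 ≤ i ∧ i < n then ((PowerSeries.coeff i.toNat f : ℤ) : ZMod q) else 0 := by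
  induction n with
  | zero =>
    rw [if_neg (by omega)]
    simp
  | succ n ih =>
    rw [polyAct_trunc_succ, coord_add, coord_zsmul, coord_iterate_shift, ih, coord_unitSeq]
    by_cases h : i - n = 0
    · obtain rfl : i = n := by omega
      simp
    · rw [if_neg h, smul_zero, add_zero]
      refine if_congr ?_ rfl rfl
      push_cast
      omega

variable (q : ℕ) [NeZero q]

noncomputable instance powerSeriesModule : Module ℤ⟦X⟧ (TwoSidedPower (ZMod q)) :=
  (isLCATorsionContractionGroup (F := ZMod q)).powerSeriesModule

theorem isPowerSeriesAction : IsPowerSeriesAction (shift (ZMod q)) :=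
  (isLCATorsionContractionGroup (F := ZMod q)).isPowerSeriesAction

theorem coord_smul_unitSeq (f : ℤ⟦X⟧) (i : ℤ) :
    coord (f • unitSeq q) i = if 0 ≤ i then ((PowerSeries.coeff i.toNat f : ℤ) : ZMod q) else 0 := by
  let y : TwoSidedPower (ZMod q) := (0, fun j => ((PowerSeries.coeff j f : ℤ) : ZMod q))
  have := (isLCATorsionContractionGroup (F := ZMod q)).t2Space
  have hy : f • unitSeq q = y := by
    refine tendsto_nhds_unique (isPowerSeriesAction q f (unitSeq q)) (tendsto_of_coord ?_ ?_)
    · refine Eventually.of_forall fun n => Finsupp.ext fun k => ?_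
      have := coord_polyAct_trunc_unitSeq q f n (Int.negSucc k)
      rw [if_neg (by omega)] at this
      exact this
    · intro j
      filter_upwards [eventually_gt_atTop j] with n hn
      have := coord_polyAct_trunc_unitSeq q f n (Int.ofNat j)
      rw [if_pos (by simp only [Int.ofNat_eq_natCast]; omega)] at this
      exact this
  rw [hy]
  match i with
  | Int.ofNat j => exact (if_pos (Int.natCast_nonneg j)).symm
  | Int.negSucc k => rw [if_neg (by omega)]; rfl

theorem isCyclicModel : IsCyclicModel q (TwoSidedPower (ZMod q)) (unitSeq q) where
  X_bijective := by
    have := (isLCATorsionContractionGroup (F := ZMod q)).t2Space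
    simp only [(isPowerSeriesAction q).X_smul]
    exact (shift (ZMod q)).bijective
  smul_eq_zero_iff f := by
    rw [PowerSeries.natCast_dvd_iff]
    constructor
    · intro h i
      have := coord_smul_unitSeq q f i
      rw [h, coord_zero, if_pos (Int.natCast_nonneg i), Int.toNat_natCast] at this
      exact (ZMod.intCast_zmod_eq_zero_iff_dvd _ _).1 this.symm
    · intro h
      refine ext_coord fun i => ?_
      rw [coord_smul_unitSeq, (ZMod.intCast_zmod_eq_zero_iff_dvd _ _).2 (h _), ite_self, coord_zero]
  exists_X_pow_smul x := by
    have := (isLCATorsionContractionGroup (F := ZMod q)).t2Space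
    obtain ⟨N, hN⟩ := exists_coord_eq_zero x
    -- Shifting by `N` clears the negative places; integer lifts of the shifted entries are the
    -- coefficients of the required series.
    choose g hg using fun j : ℕ => ZMod.intCast_surjective (coord x (j - N))
    refine ⟨N, PowerSeries.mk g, ext_coord fun i => ?_⟩
    rw [(isPowerSeriesAction q).X_pow_smul, coord_iterate_shift, coord_smul_unitSeq]
    split_ifs with h
    · rw [PowerSeries.coeff_mk, hg, Int.toNat_of_nonneg h]
    · exact hN _ (by omega)

end TwoSidedPower

/-- The module structure here is the product of those on the summands, and it agrees with power
series in the shift because limits in a product are taken componentwise. -/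
theorem LaurentSum.isPowerSeriesAction (ν : Nat.Primes × ℕ+ →₀ ℕ) :
    IsPowerSeriesAction (LaurentSum.shift ν) := by
  intro f x
  refine tendsto_pi_nhds.2 fun i => ?_
  have := TwoSidedPower.isPowerSeriesAction _ f (x i)
  refine this.congr fun n => ?_
  exact (polyAct_equivariant (α := LaurentSum.shift ν) (β := TwoSidedPower.shift _)
    (Pi.evalAddMonoidHom _ i) (fun _ => rfl) _ x).symm

/-! ### Products of cyclic modules indexed by multiplicities. -/

section Reindexing

/-- Any finite family of prime powers is enumerated by a multiplicity function. -/
theorem exists_summandIndex_equiv {J : Type*} [Finite J] (c : J → Nat.Primes × ℕ+) :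
    ∃ (ν : Nat.Primes × ℕ+ →₀ ℕ) (e : J ≃ SummandIndex ν), ∀ j, (e j).1 = c j := by
  have hfin : (Function.support fun q => Nat.card {j // c j = q}).Finite := by
    refine (Set.finite_range c).subset fun q hq => ?_
    obtain ⟨⟨j, hj⟩⟩ := (Nat.card_ne_zero.1 hq).1
    exact ⟨j, hj⟩
  refine ⟨Finsupp.ofSupportFinite _ hfin, (Equiv.sigmaFiberEquiv c).symm.trans
    (Equiv.sigmaCongrRight fun q => Finite.equivFin {j // c j = q}), fun j => rfl⟩

/-- Factors which are trivial may be dropped from a product. -/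
theorem nonempty_linearEquiv_pi_subtype (R : Type*) [Semiring R] {J : Type*} (M : J → Type*)
    [∀ j, AddCommMonoid (M j)] [∀ j, Module R (M j)] (P : J → Prop)
    (hM : ∀ j, ¬ P j → Subsingleton (M j)) :
    Nonempty (((j : J) → M j) ≃ₗ[R] ((j : {j // P j}) → M j)) := by
  classical
  refine ⟨LinearEquiv.ofBijective
    (LinearMap.pi fun j : {j // P j} => LinearMap.proj (R := R) (φ := M) j.1) ⟨fun x y h => ?_,
      fun y => ?_⟩⟩
  · funext j
    by_cases hj : P j
    · exact congrFun h ⟨j, hj⟩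
    · exact (hM j hj).elim _ _
  · refine ⟨fun j => if hj : P j then y ⟨j, hj⟩ else 0, funext fun j => ?_⟩
    simp [j.2]

theorem exists_linearEquiv_laurentSum {J : Type*} [Finite J] (M : J → Type*)
    [∀ j, AddCommGroup (M j)] [∀ j, Module ℤ⟦X⟧ (M j)] (c : J → Nat.Primes × ℕ+)
    (hM : ∀ j, Nonempty (M j ≃ₗ[ℤ⟦X⟧] TwoSidedPower (ZMod (((c j).1 : ℕ) ^ ((c j).2 : ℕ))))) :
    ∃ ν, Nonempty (((j : J) → M j) ≃ₗ[ℤ⟦X⟧] LaurentSum ν) := by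
  obtain ⟨ν, e, he⟩ := exists_summandIndex_equiv c
  have hM' : ∀ j, Nonempty
      (M j ≃ₗ[ℤ⟦X⟧] TwoSidedPower (ZMod (((e j).1.1 : ℕ) ^ ((e j).1.2 : ℕ)))) := fun j => by
    have := hM j
    rw [← he j] at this
    exact this
  exact ⟨ν, ⟨(LinearEquiv.piCongrRight fun j => (hM' j).some).trans
    (LinearEquiv.piCongrLeft ℤ⟦X⟧
      (fun i : SummandIndex ν => TwoSidedPower (ZMod ((i.1.1 : ℕ) ^ (i.1.2 : ℕ)))) e)⟩⟩

end Reindexing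

/-! ### Primary decomposition and existence of the normal form. -/

section Existence

theorem exists_linearEquiv_pi_twoSidedPower {M : Type v} [AddCommGroup M] [Module ℤ⟦X⟧ M]
    {p : ℕ} [Fact p.Prime] {e : ℕ} (he : ∀ x : M, ((p : ℤ⟦X⟧) ^ e) • x = 0)
    (hX : Function.Bijective fun x : M => (PowerSeries.X : ℤ⟦X⟧) • x)
    (F : Finset M)
    (hF : ∀ x : M, ∃ k : ℕ, (PowerSeries.X : ℤ⟦X⟧) ^ k • x ∈ Submodule.span ℤ⟦X⟧ (F : Set M)) :
    ∃ (d : ℕ) (k : Fin d → ℕ),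
      Nonempty (M ≃ₗ[ℤ⟦X⟧] ((i : Fin d) → TwoSidedPower (ZMod (p ^ k i)))) := by
  obtain ⟨d, k, ⟨φ⟩⟩ := exists_linearEquiv_pi_of_pow_smul_eq_zero he hX F hF
  exact ⟨d, k, ⟨φ.trans (LinearEquiv.piCongrRight fun i =>
    (TwoSidedPower.isCyclicModel (p ^ k i)).nonempty_linearEquiv.some)⟩⟩

/-- A module of finite exponent over the power series ring, on which `X` is invertible, and which
is finitely generated up to powers of `X`, is a finite direct sum of modules of Laurent series over
the rings `ℤ/pⁿℤ`. -/
theorem exists_linearEquiv_laurentSum_of_smul_eq_zero {M : Type v} [AddCommGroup M]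
    [Module ℤ⟦X⟧ M] {m : ℕ} (hm : m ≠ 0) (hmM : ∀ x : M, (m : ℤ⟦X⟧) • x = 0)
    (hX : Function.Bijective fun x : M => (PowerSeries.X : ℤ⟦X⟧) • x)
    (F : Finset M)
    (hF : ∀ x : M, ∃ k : ℕ, (PowerSeries.X : ℤ⟦X⟧) ^ k • x ∈ Submodule.span ℤ⟦X⟧ (F : Set M)) :
    ∃ ν, Nonempty (M ≃ₗ[ℤ⟦X⟧] LaurentSum ν) := by
  classical
  let q : ℕ → ℤ⟦X⟧ := fun p => (p : ℤ⟦X⟧) ^ m.factorization p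
  have hprod : ∏ p ∈ m.primeFactors, q p = m := by
    conv_rhs => rw [← Nat.prod_factorization_pow_eq_self hm]
    rw [Finsupp.prod, Nat.support_factorization, Nat.cast_prod]
    simp [q]
  have hcop : (m.primeFactors : Set ℕ).Pairwise (Function.onFun IsCoprime q) := by
    intro a ha b hb hab
    have hab' : Nat.Coprime a b := (Nat.coprime_primes (Nat.prime_of_mem_primeFactors ha)
      (Nat.prime_of_mem_primeFactors hb)).2 hab
    exact (Nat.Coprime.cast hab').pow
  have hint := Submodule.torsionBy_isInternal (M := M) hcop (by rw [hprod]; exact hmM)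
  let N : m.primeFactors → Submodule ℤ⟦X⟧ M := fun p => Submodule.torsionBy ℤ⟦X⟧ M (q p)
  let E : M ≃ₗ[ℤ⟦X⟧] ((p : m.primeFactors) → N p) :=
    (LinearEquiv.ofBijective (DirectSum.coeLinearMap N) hint).symm.trans
      (DirectSum.linearEquivFunOnFintype _ _ _)
  have hne : ∀ p : m.primeFactors, NeZero (p : ℕ) := fun p =>
    ⟨(Nat.prime_of_mem_primeFactors p.2).ne_zero⟩
  have hN : ∀ p : m.primeFactors, ∃ (d : ℕ) (k : Fin d → ℕ),
      Nonempty (N p ≃ₗ[ℤ⟦X⟧] ((i : Fin d) → TwoSidedPower (ZMod ((p : ℕ) ^ k i)))) := by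
    intro p
    have : Fact (p : ℕ).Prime := ⟨Nat.prime_of_mem_primeFactors p.2⟩
    refine exists_linearEquiv_pi_twoSidedPower (e := m.factorization p)
      (fun x => Submodule.smul_torsionBy _ _) ⟨fun x y hxy => ?_, fun x => ?_⟩
      (F.image fun x => E x p) fun x => ?_
    · exact Subtype.ext (hX.1 (congrArg Subtype.val hxy))
    · obtain ⟨y, hy⟩ := hX.2 (x : M)
      refine ⟨⟨y, ?_⟩, Subtype.ext hy⟩
      refine (Submodule.mem_torsionBy_iff _ _).2 (hX.1 ?_)
      change PowerSeries.X • q p • y = PowerSeries.X • (0 : M)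
      change PowerSeries.X • y = (x : M) at hy
      rw [smul_comm, hy, smul_zero]
      exact (Submodule.mem_torsionBy_iff _ _).1 x.2
    -- Applying the finiteness condition to `x` placed in the component `p`, then projecting, gives
    -- it for that component.
    · obtain ⟨k, hk⟩ := hF (E.symm (Pi.single p x))
      refine ⟨k, ?_⟩
      have := Submodule.mem_map_of_mem (f := (LinearMap.proj p).comp E.toLinearMap) hk
      rw [Submodule.map_span] at this
      simpa using this
  choose d k hk using hN
  let J : Type := Σ p : m.primeFactors, Fin (d p)
  let ψ : M ≃ₗ[ℤ⟦X⟧] ((j : J) → TwoSidedPower (ZMod ((j.1 : ℕ) ^ k j.1 j.2))) :=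
    (E.trans (LinearEquiv.piCongrRight fun p => (hk p).some)).trans
      (LinearEquiv.piCurry ℤ⟦X⟧
        (fun (p : m.primeFactors) (i : Fin (d p)) => TwoSidedPower (ZMod ((p : ℕ) ^ k p i)))).symm
  -- The structure theorem allows exponent zero. Those factors are trivial and are discarded, since
  -- `ν` is indexed by positive exponents.
  obtain ⟨χ⟩ := nonempty_linearEquiv_pi_subtype ℤ⟦X⟧
    (fun j : J => TwoSidedPower (ZMod ((j.1 : ℕ) ^ k j.1 j.2))) (fun j => 0 < k j.1 j.2)
    (fun j hj => by
      have hj : k j.1 j.2 = 0 := by omega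
      rw [hj, pow_zero]
      exact ⟨fun x y => TwoSidedPower.ext_coord fun i => Subsingleton.elim (α := ZMod 1) _ _⟩)
  obtain ⟨ν, ⟨ω⟩⟩ := exists_linearEquiv_laurentSum
    (fun j : {j : J // 0 < k j.1 j.2} => TwoSidedPower (ZMod ((j.1.1 : ℕ) ^ k j.1.1 j.1.2)))
    (fun j => (⟨j.1.1, Nat.prime_of_mem_primeFactors j.1.1.2⟩, ⟨k j.1.1 j.1.2, j.2⟩))
    (fun j => ⟨LinearEquiv.refl _ _⟩)
  exact ⟨ν, ⟨(ψ.trans χ).trans ω⟩⟩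

theorem IsLCATorsionContractionGroup.exists_contractionIso {G : Type u} [AddCommGroup G]
    [TopologicalSpace G] {α : G ≃ₜ+ G} (h : IsLCATorsionContractionGroup G α) :
    ∃ ν, ContractionIso α (LaurentSum.shift ν) := by
  have := h.isTopologicalAddGroup
  have := h.t2Space
  have := h.locallyCompactSpace
  let _ := h.powerSeriesModule
  have hact : IsPowerSeriesAction α := h.isPowerSeriesAction
  obtain ⟨W, hW⟩ := h.exists_isContractionLattice
  obtain ⟨F, hF⟩ := hact.exists_finset_lattice_le_span hW
  obtain ⟨m, hm, hmG⟩ := exists_nsmul_eq_zero_of_contractive h.isTorsion α h.contractive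
  obtain ⟨ν, ⟨φ⟩⟩ := exists_linearEquiv_laurentSum_of_smul_eq_zero (M := G) hm.ne'
    (fun x => by rw [Nat.cast_smul_eq_nsmul, hmG])
    (by simp only [hact.X_smul]; exact α.bijective) F
    (fun x => by
      obtain ⟨k, hk⟩ := hW.exists_iterate_mem_lattice h.contractive x
      exact ⟨k, by rw [hact.X_pow_smul]; exact hF _ hk⟩)
  exact ⟨ν, hact.contractionIso_of_linearEquiv h (LaurentSum.isLCATorsionContractionGroup ν)
    (LaurentSum.isPowerSeriesAction ν) φ⟩

end Existence

/-! ### Recovering the multiplicities by counting torsion. -/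

section Uniqueness

namespace LaurentSum

variable {ν μ : Nat.Primes × ℕ+ →₀ ℕ}

/-- The two-sided sequences without entries at negative places. -/
def lattice (ν : Nat.Primes × ℕ+ →₀ ℕ) : Set (LaurentSum ν) :=
  {x | ∀ i, ∀ n : ℤ, n < 0 → TwoSidedPower.coord (x i) n = 0}

theorem lattice_eq_pi (ν : Nat.Primes × ℕ+ →₀ ℕ) :
    lattice ν = Set.univ.pi fun _ => {x | x.1 = 0} := by
  ext x
  simp only [Set.mem_pi, Set.mem_univ, true_imp_iff]
  refine forall_congr' fun i => ⟨fun h => ?_, fun h n hn => ?_⟩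
  · exact Finsupp.ext fun k => h (Int.negSucc k) (Int.negSucc_lt_zero k)
  · match n with
    | Int.ofNat j => simp only [Int.ofNat_eq_natCast] at hn; omega
    | Int.negSucc k => exact DFunLike.congr_fun h k

theorem isCompact_lattice (ν : Nat.Primes × ℕ+ →₀ ℕ) : IsCompact (lattice ν) := by
  rw [lattice_eq_pi]
  refine isCompact_univ_pi fun i => ?_
  let F := ZMod ((i.1.1 : ℕ) ^ (i.1.2 : ℕ))
  let _ : TopologicalSpace F := ⊥
  let _ : TopologicalSpace (ℕ →₀ F) := ⊥
  have : {x : (ℕ →₀ F) × (ℕ → F) | x.1 = 0} = {0} ×ˢ Set.univ := by ext; simp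
  change IsCompact {x : (ℕ →₀ F) × (ℕ → F) | x.1 = 0}
  rw [this]
  exact isCompact_singleton.prod isCompact_univ

theorem lattice_mem_nhds (ν : Nat.Primes × ℕ+ →₀ ℕ) : lattice ν ∈ 𝓝 0 := by
  rw [lattice_eq_pi]
  refine set_pi_mem_nhds Set.finite_univ fun i _ => ?_
  let F := ZMod ((i.1.1 : ℕ) ^ (i.1.2 : ℕ))
  let _ : TopologicalSpace F := ⊥
  let _ : TopologicalSpace (ℕ →₀ F) := ⊥
  have : DiscreteTopology (ℕ →₀ F) := ⟨rfl⟩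
  change {x : (ℕ →₀ F) × (ℕ → F) | x.1 = 0} ∈ 𝓝 0
  exact ((isOpen_discrete {(0 : ℕ →₀ F)}).preimage continuous_fst).mem_nhds rfl

theorem coord_iterate_shift (n : ℕ) (x : LaurentSum ν) (i : SummandIndex ν) (j : ℤ) :
    TwoSidedPower.coord ((shift ν : LaurentSum ν → LaurentSum ν)^[n] x i) j =
      TwoSidedPower.coord (x i) (j - n) := by
  rw [iterate_shift_apply, TwoSidedPower.coord_iterate_shift]

/-- A continuous map moves the places of entries to the left by a bounded amount. -/
theorem exists_coord_eq_zero_of_continuous (φ : LaurentSum ν → LaurentSum μ) (hφ : Continuous φ) :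
    ∃ m : ℕ, ∀ x ∈ lattice ν, ∀ i, ∀ n : ℤ, n < -m → TwoSidedPower.coord (φ x i) n = 0 := by
  have h := isLCATorsionContractionGroup μ
  have := h.isTopologicalAddGroup
  have := h.t2Space
  have := h.locallyCompactSpace
  obtain ⟨m, hm⟩ := exists_forall_iterate_mem_of_isCompact (shift μ) h.contractive
    ((isCompact_lattice ν).image hφ) (lattice_mem_nhds μ)
  refine ⟨m, fun x hx i n hn => ?_⟩
  have := hm m le_rfl _ (Set.mem_image_of_mem φ hx) i (n + m) (by omega)
  rwa [coord_iterate_shift, add_sub_cancel_right] at this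

/-- The elements of exponent `t` in the finite group of constant terms. -/
abbrev TorsionTerms (t : ℕ) (ν : Nat.Primes × ℕ+ →₀ ℕ) : Type :=
  (i : SummandIndex ν) →
    (nsmulAddMonoidHom t : ZMod ((i.1.1 : ℕ) ^ (i.1.2 : ℕ)) →+ _).ker

/-- The sequence whose entries are prescribed at the places `0, …, k - 1`, and zero elsewhere. -/
def ofTerms {t k : ℕ} (b : Fin k → TorsionTerms t ν) : LaurentSum ν :=
  fun i => (0, fun j => if h : j < k then (b ⟨j, h⟩ i : ZMod _) else 0)

theorem ofTerms_mem_lattice {t k : ℕ} (b : Fin k → TorsionTerms t ν) :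
    ofTerms b ∈ lattice ν := by
  rw [lattice_eq_pi]
  exact fun i _ => rfl

theorem coord_ofTerms {t k : ℕ} (b : Fin k → TorsionTerms t ν) (i : SummandIndex ν) (j : Fin k) :
    TwoSidedPower.coord (ofTerms b i) (j : ℕ) = b j i :=
  dif_pos j.2

theorem nsmul_ofTerms {t k : ℕ} (b : Fin k → TorsionTerms t ν) : t • ofTerms b = 0 := by
  refine funext fun i => Prod.ext (smul_zero t) (funext fun j => ?_)
  change t • (ofTerms b i).2 j = 0
  unfold ofTerms
  dsimp only
  split_ifs with h
  · exact (b ⟨j, h⟩ i).2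
  · exact smul_zero t

/-- If `φ` and its inverse move entries to the left by at most `m` and `m'`, a sequence supported on
`k` places is determined by the entries of its image at the `k + m + m'` places from `-m` to `k + m'
- 1`. Counting sequences killed by `t` gives the bound. -/
theorem exists_card_torsionTerms_pow_le (t : ℕ)
    (h : ContractionIso (shift ν) (shift μ)) :
    ∃ M : ℕ, ∀ k : ℕ, Nat.card (TorsionTerms t ν) ^ k ≤ Nat.card (TorsionTerms t μ) ^ (k + M) := by
  obtain ⟨φ, hφ⟩ := h
  obtain ⟨m, hm⟩ := exists_coord_eq_zero_of_continuous φ φ.continuous_toFun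
  obtain ⟨m', hm'⟩ := exists_coord_eq_zero_of_continuous φ.symm φ.symm.continuous_toFun
  have hiter : ∀ (n : ℕ) (x : LaurentSum ν),
      φ ((shift ν : LaurentSum ν → LaurentSum ν)^[n] x) =
        (shift μ : LaurentSum μ → LaurentSum μ)^[n] (φ x) := fun n x => by
    induction n with
    | zero => rfl
    | succ n ih => rw [Function.iterate_succ_apply', Function.iterate_succ_apply', hφ, ih]
  -- Shifting back by `k + m'` turns the vanishing hypothesis into membership of the lattice, where
  -- the bound for `φ.symm` applies.
  have hzero : ∀ (w : LaurentSum ν) (k : ℕ),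
      (∀ i, ∀ n : ℤ, n < k + m' → TwoSidedPower.coord (φ w i) n = 0) →
      ∀ i, ∀ n : ℤ, n < k → TwoSidedPower.coord (w i) n = 0 := by
    intro w k hw i n hn
    obtain ⟨w', rfl⟩ := (shift ν).surjective.iterate (k + m') w
    rw [coord_iterate_shift]
    have hw' : φ w' ∈ lattice μ := fun i n hn => by
      have := hw i (n + (k + m' : ℕ)) (by push_cast; omega)
      rwa [hiter, coord_iterate_shift, add_sub_cancel_right] at this
    have := hm' _ hw' i (n - (k + m' : ℕ)) (by push_cast; omega)
    rwa [φ.symm_apply_apply] at this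
  refine ⟨m + m', fun k => ?_⟩
  let Θ : (Fin k → TorsionTerms t ν) → (Fin (k + (m + m')) → TorsionTerms t μ) :=
    fun b n i => ⟨TwoSidedPower.coord (φ (ofTerms b) i) (n - m), by
      rw [AddMonoidHom.mem_ker, nsmulAddMonoidHom_apply, ← TwoSidedPower.coord_nsmul,
        ← Pi.smul_apply, ← map_nsmul, nsmul_ofTerms, map_zero, Pi.zero_apply,
        TwoSidedPower.coord_zero]⟩
  have hΘ : Function.Injective Θ := by
    intro b b' hbb'
    have hsub : ∀ i, ∀ n : ℤ, n < k →
        TwoSidedPower.coord ((ofTerms b - ofTerms b') i) n = 0 := by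
      refine hzero _ k fun i n hn => ?_
      rw [map_sub, Pi.sub_apply, TwoSidedPower.coord_sub, sub_eq_zero]
      by_cases hnm : n < -m
      · rw [hm _ (ofTerms_mem_lattice b) i n hnm, hm _ (ofTerms_mem_lattice b') i n hnm]
      · have := congrArg Subtype.val
          (congrFun (congrFun hbb' ⟨(n + m).toNat, by omega⟩) i)
        simp only [Θ] at this
        rwa [Int.toNat_of_nonneg (by omega), add_sub_cancel_right] at this
    refine funext fun j => funext fun i => Subtype.ext ?_
    have := hsub i (j : ℕ) (by exact_mod_cast j.2)
    rwa [Pi.sub_apply, TwoSidedPower.coord_sub, sub_eq_zero, coord_ofTerms, coord_ofTerms] at this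
  have := Nat.card_le_card_of_injective Θ hΘ
  simpa [Nat.card_fun] using this

/-- Otherwise the powers of `a / b > 1` would be bounded by `b^M`. -/
theorem _root_.Nat.le_of_forall_pow_le_pow_add {a b M : ℕ} (hb : 0 < b)
    (h : ∀ k : ℕ, a ^ k ≤ b ^ (k + M)) : a ≤ b := by
  by_contra! hab
  have hb' : (0 : ℝ) < b := by exact_mod_cast hb
  obtain ⟨k, hk⟩ := pow_unbounded_of_one_lt ((b : ℝ) ^ M)
    ((one_lt_div hb').2 (by exact_mod_cast hab : (b : ℝ) < a))
  rw [div_pow, lt_div_iff₀ (by positivity), ← pow_add, add_comm] at hk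
  have := h k
  exact absurd this (not_le.2 (by exact_mod_cast hk))

theorem card_torsionTerms_eq (t : ℕ) (h : ContractionIso (shift ν) (shift μ)) :
    Nat.card (TorsionTerms t ν) = Nat.card (TorsionTerms t μ) := by
  have h' : ContractionIso (shift μ) (shift ν) := by
    obtain ⟨φ, hφ⟩ := h
    refine ⟨φ.symm, fun y => φ.injective ?_⟩
    rw [hφ, φ.apply_symm_apply, φ.apply_symm_apply]
  obtain ⟨M, hM⟩ := exists_card_torsionTerms_pow_le t h
  obtain ⟨M', hM'⟩ := exists_card_torsionTerms_pow_le t h'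
  exact le_antisymm (Nat.le_of_forall_pow_le_pow_add Nat.card_pos hM)
    (Nat.le_of_forall_pow_le_pow_add Nat.card_pos hM')

/-- In a cyclic group of order `N` the elements killed by `t` number `gcd N t`; for prime powers
this is `p^(min n j)` or `1`. -/
theorem card_torsionTerms_prime_pow (p : Nat.Primes) (j : ℕ) (ν : Nat.Primes × ℕ+ →₀ ℕ) :
    Nat.card (TorsionTerms ((p : ℕ) ^ j) ν) =
      (p : ℕ) ^ (ν.sum fun q c => c * if q.1 = p then min (q.2 : ℕ) j else 0) := by
  classical
  have hker : ∀ q : Nat.Primes × ℕ+, Nat.card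
      (nsmulAddMonoidHom ((p : ℕ) ^ j) : ZMod ((q.1 : ℕ) ^ (q.2 : ℕ)) →+ _).ker =
        (p : ℕ) ^ (if q.1 = p then min (q.2 : ℕ) j else 0) := by
    intro q
    rw [IsAddCyclic.card_nsmulAddMonoidHom_ker, Nat.card_zmod]
    split_ifs with h
    · rw [h]
      rcases le_total (q.2 : ℕ) j with h' | h'
      · rw [min_eq_left h', Nat.gcd_eq_left (pow_dvd_pow _ h')]
      · rw [min_eq_right h', Nat.gcd_eq_right (pow_dvd_pow _ h')]
    · rw [pow_zero]
      exact Nat.Coprime.pow _ _ ((Nat.coprime_primes q.1.2 p.2).2 fun h' => h (Subtype.ext h'))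
  have := Fintype.ofFinite (SummandIndex ν)
  rw [Nat.card_pi]
  simp only [hker]
  rw [Finset.prod_pow_eq_pow_sum]
  congr 1
  rw [Finsupp.sum, ← Finset.sum_fiberwise_of_maps_to (g := Sigma.fst) (t := ν.support)]
  · refine Finset.sum_congr rfl fun q _ => ?_
    have hcard : (Finset.univ.filter fun x : SummandIndex ν => x.1 = q).card = ν q := by
      rw [← Fintype.card_subtype, Fintype.card_congr (Equiv.sigmaSubtype q), Fintype.card_fin]
    rw [Finset.sum_congr rfl fun x hx => by rw [(Finset.mem_filter.1 hx).2], Finset.sum_const,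
      hcard, smul_eq_mul]
  · intro x _
    rw [Finsupp.mem_support_iff]
    exact fun h => (Fin.cast h x.2).elim0

/-- The function `j ↦ min m j` is linear except for a kink at `j = m`, so a second difference of the
exponents at `n` isolates `ν (p, n)`. -/
theorem eq_of_contractionIso (h : ContractionIso (shift ν) (shift μ)) : ν = μ := by
  have hsum : ∀ (p : Nat.Primes) (j : ℕ),
      (ν.sum fun q c => c * if q.1 = p then min (q.2 : ℕ) j else 0) =
        μ.sum fun q c => c * if q.1 = p then min (q.2 : ℕ) j else 0 := fun p j => by
    have := card_torsionTerms_eq ((p : ℕ) ^ j) h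
    rw [card_torsionTerms_prime_pow, card_torsionTerms_prime_pow] at this
    exact Nat.pow_right_injective p.2.two_le this
  -- The second difference is arranged as a sum on each side to avoid subtracting sums in `ℕ`; `n -
  -- 1` is genuine because `n` is positive.
  have hrec : ∀ (ν : Nat.Primes × ℕ+ →₀ ℕ) (p : Nat.Primes) (n : ℕ+),
      (ν.sum fun q c => c * if q.1 = p then min (q.2 : ℕ) n else 0) +
        (ν.sum fun q c => c * if q.1 = p then min (q.2 : ℕ) n else 0) =
      (ν.sum fun q c => c * if q.1 = p then min (q.2 : ℕ) (n - 1) else 0) +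
        (ν.sum fun q c => c * if q.1 = p then min (q.2 : ℕ) (n + 1) else 0) + ν (p, n) := by
    intro ν p n
    have hν : ν (p, n) = ν.sum fun q c => if q = (p, n) then c else 0 := by
      rw [Finsupp.sum_ite_self_eq']
    rw [hν, ← Finsupp.sum_add, ← Finsupp.sum_add, ← Finsupp.sum_add]
    have hpos := n.pos
    refine Finsupp.sum_congr fun q _ => ?_
    by_cases hp : q.1 = p
    · by_cases hn : q.2 = n
      · have hq : q = (p, n) := Prod.ext hp hn
        have h₀ : min (n : ℕ) (n - 1) = n - 1 := by omega
        have h₁ : min (n : ℕ) (n + 1) = n := by omega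
        simp only [hq, if_true, min_self, h₀, h₁]
        rw [add_right_comm, add_left_inj, ← Nat.mul_succ, Nat.succ_eq_add_one,
          Nat.sub_add_cancel hpos]
      · have hq : q ≠ (p, n) := fun h => hn (by rw [h])
        have hn' : (q.2 : ℕ) ≠ n := fun h => hn (PNat.coe_injective h)
        simp only [hp, hq, if_true, if_false, add_zero]
        rw [← mul_add, ← mul_add]
        have h₀ : min (q.2 : ℕ) n + min (q.2 : ℕ) n =
            min (q.2 : ℕ) (n - 1) + min (q.2 : ℕ) (n + 1) := by omega
        rw [h₀]
    · have hq : q ≠ (p, n) := fun h => hp (by rw [h])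
      simp only [hp, hq, if_false, mul_zero, add_zero]
  ext ⟨p, n⟩
  have h₁ := hrec ν p n
  have h₂ := hrec μ p n
  rw [hsum, hsum, hsum] at h₁
  omega

end LaurentSum

end Uniqueness

/-! ### The classification and countability. -/

theorem corollary5 :
    (∀ ν : Nat.Primes × ℕ+ →₀ ℕ,
      IsLCATorsionContractionGroup (LaurentSum ν) (LaurentSum.shift ν)) ∧
    (∀ (G : Type u) [AddCommGroup G] [TopologicalSpace G] (α : G ≃ₜ+ G),
      IsLCATorsionContractionGroup G α →
        ∃! ν : Nat.Primes × ℕ+ →₀ ℕ, ContractionIso α (LaurentSum.shift ν)) ∧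
    Countable (Quotient LCATorsionContractionGroup.isoSetoid.{u}) := by
  refine ⟨LaurentSum.isLCATorsionContractionGroup, fun G _ _ α h => ?_, ?_⟩
  · obtain ⟨ν, φ, hφ⟩ := h.exists_contractionIso
    refine ⟨ν, ⟨φ, hφ⟩, fun μ hμ => ?_⟩
    obtain ⟨ψ, hψ⟩ := hμ
    refine LaurentSum.eq_of_contractionIso ⟨ψ.symm.trans φ, fun y => ?_⟩
    obtain ⟨x, rfl⟩ := ψ.surjective y
    change φ (ψ.symm (LaurentSum.shift μ (ψ x))) = LaurentSum.shift ν (φ (ψ.symm (ψ x)))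
    rw [← hψ, ψ.symm_apply_apply, ψ.symm_apply_apply, hφ]
  · choose ν hν using fun A : LCATorsionContractionGroup.{u} => A.prop.exists_contractionIso
    -- Classes with the same `ν` are isomorphic through the common normal form, so they embed in the
    -- countable set of finitely supported families.
    refine Function.Injective.countable
      (f := fun a : Quotient LCATorsionContractionGroup.isoSetoid.{u} => ν a.out) fun a b hab => ?_
    rw [← a.out_eq, ← b.out_eq]
    refine Quotient.sound ?_
    obtain ⟨φ, hφ⟩ := hν a.out
    obtain ⟨ψ, hψ⟩ : ContractionIso b.out.aut (LaurentSum.shift (ν a.out)) := by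
      have hab : ν a.out = ν b.out := hab
      rw [hab]
      exact hν b.out
    refine ⟨φ.trans ψ.symm, fun x => ψ.injective ?_⟩
    change ψ (ψ.symm (φ (a.out.aut x))) = ψ (b.out.aut (ψ.symm (φ x)))
    rw [hψ, ψ.apply_symm_apply, ψ.apply_symm_apply, hφ]
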